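/- Let $\hbar>0$. Let $\mathcal H_s$ be a finite-dimensional complex Hilbert space (the system) with self-adjoint Hamiltonian $H_s$, orthonormal energy eigenbasis $(|E_j\rangle)_j$ and energy levels $E_j$. Let the weight be $L^2(\mathbb R)$ with Hamiltonian $H_w=X_w$ (the position operator) and momentum operator $P_w$, and let the engine be $\mathcal H_s\otimes L^2(\mathbb R)$ with Hamiltonian $H_e=H_s\otimes 1+1\otimes X_w$. Let $V_s$ be any unitary on $\mathcal H_s$ and $p_0\in\mathbb R$, and put $$U_e=\sum_{n,j}\langle E_n|V_s|E_j\rangle\,|E_n\rangle\langle E_j|\otimes e^{-\frac i\hbar(P_w-p_0)(E_j-E_n)},\qquad U_s(p)=\sum_{n,j}e^{-\frac i\hbar(p-p_0)(E_j-E_n)}\langle E_n|V_s|E_j\rangle\,|E_n\rangle\langle E_j|.$$ For a density operator $\rho_w$ of the weight, its momentum distribution $\mu_w(p)=\langle p|\rho_w|p\rangle$ is the integrable nonnegative function, unique up to null sets, with $\operatorname{Tr}(\rho_w 1_A(P_w))=\int_A\mu_w(p)\,dp$ for all Borel sets $A$. Then: 1. $U_e$ is unitary, $[U_e,H_e]=0$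 and $[U_e,1\otimes P_w]=0$ (that is, $U_e$ preserves the domain of the unbounded operator and commutes with it there). 2. Each $U_s(p)$ is unitary, $U_s(p_0)=V_s$, and $U_e=\int_{\mathbb R}U_s(p)\otimes|p\rangle\langle p|\,dp$ in the weak sense. 3. Every weight state has a momentum distribution, and its total mass is $1$. 4. For all density operators $\rho_s$ of the system and $\rho_w$ of the weight, with $\rho_e=\rho_s\otimes\rho_w$, the integral below converges and $$\operatorname{Tr}_w[U_e\rho_eU_e^\dagger]=\int_{\mathbb R}\mu_w(p)\,U_s(p)\rho_sU_s(p)^\dagger\,dp.$$ 5. For every probability density $\mu$ on $\mathbb R$ (in particular one with mean $p_0$) and every $\epsilon>0$ there is $\delta_0>0$ such that for all $0<\delta\le\delta_0$: there is a weight state with momentum distribution $\mu_\delta(p)=\frac1\delta\,\mu\!\left(\frac{p-p_0}\delta+p_0\right)$, and for every such weight state $\rho_w$ and every system state $\rho_s$, $$\left\|\operatorname{Tr}_w[U_e\rho_eU_e^\dagger]-V_s\rho_sV_s^\dagger\right\|_1\le\epsilon .\qquad(*)$$ 6. The error depends only on how narrow $\mu_w$ is: for every $\epsilon>0$ there is $\eta>0$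 such that $(*)$ holds for every $\rho_s$ and every $\rho_w$ with $\int_{|p-p_0|\ge\eta}\mu_w(p)\,dp\le\eta$. 7. The weight is not degraded by the operation: for all states $\rho_s,\rho_w$, the final reduced weight state $\operatorname{Tr}_s[U_e\rho_eU_e^\dagger]$ is a density operator with the same momentum distribution as $\rho_w$. The weight's free evolution $e^{-itX_w/\hbar}$ is unitary and only translates the momentum distribution, $\mu_w(p)\mapsto\mu_w(p+t)$. 8. If $V_s|E_j\rangle=|E_{\pi(j)}\rangle$ for all $j$, for a permutation $\pi$, and $\rho_s=\sum_n q_n|E_n\rangle\langle E_n|$ is a density operator, then $\operatorname{Tr}_w[U_e\rho_eU_e^\dagger]=V_s\rho_sV_s^\dagger$ exactly, for every weight state $\rho_w$. -/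

import Mathlib

open MeasureTheory TensorProduct InnerProductSpace
open scoped ComplexConjugate ENNReal

noncomputable section

namespace QuantumWeight

universe u v

/-! ### States, traces and partial traces -/

section States

variable {H : Type u} [NormedAddCommGroup H] [InnerProductSpace ℂ H] [CompleteSpace H]

/-- `T` is of trace class and `Tr T = c`: for every Hilbert basis `e`, the series
`∑ i, ⟪e i, T (e i)⟫` converges unconditionally to `c`. -/
def HasTrace (T : H →L[ℂ] H) (c : ℂ) : Prop :=
  ∀ (κ : Type u) (e : HilbertBasis κ ℂ H), HasSum (fun k => inner ℂ (e k) (T (e k))) c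

/-- Density operators: positive operators of trace one. -/
def IsDensityOperator (ρ : H →L[ℂ] H) : Prop :=
  ρ.IsPositive ∧ HasTrace ρ 1

/-- Trace norm of an operator on a finite-dimensional Hilbert space: the sum of its singular
values, i.e. `Tr |T|`. -/
def traceNorm [FiniteDimensional ℂ H] (T : H →L[ℂ] H) : ℝ :=
  (T : H →ₗ[ℂ] H).singularValues.sum fun _ s => s

end States

section Composite

variable {S : Type u} [NormedAddCommGroup S] [InnerProductSpace ℂ S] [FiniteDimensional ℂ S]
  {W : Type v} [NormedAddCommGroup W] [InnerProductSpace ℂ W] [CompleteSpace W]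

/-- `S ⊗ W` is a Hilbert space when `S` is finite-dimensional, so the algebraic tensor product
needs no completion. -/
instance completeSpace_tensorProduct : CompleteSpace (S ⊗[ℂ] W) := by
  let b := stdOrthonormalBasis ℂ S
  let Ψ : (S ⊗[ℂ] W) →L[ℂ] (Fin (Module.finrank ℂ S) → W) :=
    ContinuousLinearMap.pi fun i =>
      ((TensorProduct.lidIsometry ℂ W : (ℂ ⊗[ℂ] W) →L[ℂ] W)) ∘L
        ContinuousLinearMap.rTensor W (innerSL ℂ (b i))
  let Φ : (Fin (Module.finrank ℂ S) → W) →L[ℂ] (S ⊗[ℂ] W) :=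
    ∑ i, TensorProduct.mkL ℂ S W (b i) ∘L ContinuousLinearMap.proj i
  have h1 : ∀ x, Φ (Ψ x) = x := by
    intro x
    induction x using TensorProduct.induction_on with
    | zero => simp
    | add x y hx hy => rw [map_add, map_add, hx, hy]
    | tmul s w =>
      have h : (Φ (Ψ (s ⊗ₜ[ℂ] w))) = ∑ i, b i ⊗ₜ[ℂ] (inner ℂ (b i) s • w) := by
        simp [Φ, Ψ]
      rw [h]
      simp_rw [← TensorProduct.smul_tmul, ← TensorProduct.sum_tmul]
      rw [b.sum_repr' s]
  have h2 : ∀ x, Ψ (Φ x) = x := by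
    intro x
    ext i
    simp [Φ, Ψ, orthonormal_iff_ite.mp b.orthonormal]
  exact ((ContinuousLinearEquiv.equivOfInverse Ψ Φ h1 h2).isUniformEmbedding.isUniformInducing
    |>.completeSpace_congr (ContinuousLinearEquiv.equivOfInverse Ψ Φ h1 h2).surjective).mpr
      inferInstance

/-- `Tr_W T = R`: for all `a, a'` in `S`, the operator `(⟨a| ⊗ 1) T (|a'⟩ ⊗ 1)` on `W` is of trace
class with trace `⟨a| R |a'⟩`. -/
def HasPartialTrace (T : (S ⊗[ℂ] W) →L[ℂ] (S ⊗[ℂ] W)) (R : S →L[ℂ] S) : Prop :=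
  ∀ a a' : S, HasTrace
    ((TensorProduct.mkL ℂ S W a).adjoint ∘L T ∘L TensorProduct.mkL ℂ S W a')
    (inner ℂ a (R a'))

/-- `Tr_S T = ∑ i, (⟨b i| ⊗ 1) T (|b i⟩ ⊗ 1)` for an orthonormal basis `b` of `S` (the choice of
basis is immaterial). -/
def partialTraceLeft (T : (S ⊗[ℂ] W) →L[ℂ] (S ⊗[ℂ] W)) : W →L[ℂ] W :=
  ∑ i, (TensorProduct.mkL ℂ S W (stdOrthonormalBasis ℂ S i)).adjoint ∘L T ∘L
    TensorProduct.mkL ℂ S W (stdOrthonormalBasis ℂ S i)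

end Composite

/-! ### Unbounded operators -/

/-- The (possibly unbounded) operator `A` commutes with the bounded operator `U`: `U` maps the
domain of `A` into itself and `A U = U A` there. -/
def Commutes {H : Type u} [NormedAddCommGroup H] [InnerProductSpace ℂ H]
    (U : H →L[ℂ] H) (A : H →ₗ.[ℂ] H) : Prop :=
  ∀ x : A.domain, ∃ h : U x ∈ A.domain, A ⟨U x, h⟩ = U (A x)

/-- The operator `1 ⊗ A` with domain `S ⊗ dom A`. -/
def oneTensor (S : Type u) [NormedAddCommGroup S] [InnerProductSpace ℂ S]
    {W : Type v} [NormedAddCommGroup W] [InnerProductSpace ℂ W]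
    (A : W →ₗ.[ℂ] W) : (S ⊗[ℂ] W) →ₗ.[ℂ] (S ⊗[ℂ] W) where
  domain := LinearMap.range (A.domain.subtype.lTensor S)
  toFun := (A.toFun.lTensor S) ∘ₗ
    (LinearEquiv.ofInjective (A.domain.subtype.lTensor S)
      (Module.Flat.lTensor_preserves_injective_linearMap _
        A.domain.injective_subtype)).symm.toLinearMap

/-! ### The weight -/

/-- The Hilbert space `L²(ℝ)` of the weight, in position representation. -/
abbrev Weight : Type := Lp ℂ 2 (volume : Measure ℝ)

/-- The unitary Fourier transform `ψ ↦ (ξ ↦ ∫ exp (-2πixξ) ψ x dx)` on `L²(ℝ)`; the momentum is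
`p = 2πħξ`. -/
abbrev fourierW : Weight ≃ₗᵢ[ℂ] Weight := Lp.fourierTransformₗᵢ ℝ ℂ

/-- The momentum wave function `⟨p|ψ⟩ = (2πħ)^(-1/2) ∫ exp (-ixp/ħ) ψ x dx`. -/
def momentumWave (ħ : ℝ) (ψ : Weight) (p : ℝ) : ℂ :=
  ((Real.sqrt (2 * Real.pi * ħ))⁻¹ : ℝ) * (fourierW ψ) (p / (2 * Real.pi * ħ))

open Classical in
/-- Multiplication by an essentially bounded function `g` on `L²(ℝ)` (it is only used for such
`g`, and is `0` otherwise). -/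
def mulBounded (g : ℝ → ℂ) : Weight →L[ℂ] Weight :=
  if hg : MemLp g ∞ (volume : Measure ℝ) then
    (ContinuousLinearMap.mul ℂ ℂ).holderL volume ∞ 2 2 hg.toLp
  else 0

/-- The bounded function `f(P)` of the momentum operator `P`. -/
def momentumFun (ħ : ℝ) (f : ℝ → ℂ) : Weight →L[ℂ] Weight :=
  (fourierW.symm : Weight →L[ℂ] Weight) ∘L mulBounded (fun ξ => f (2 * Real.pi * ħ * ξ)) ∘L
    (fourierW : Weight →L[ℂ] Weight)

/-- The maximal operator of multiplication by `g`, with domain `{ψ | g ψ ∈ L²}`. -/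
def mulUnbounded (g : ℝ → ℂ) : Weight →ₗ.[ℂ] Weight where
  domain :=
    { carrier := {ψ | MemLp (fun x => g x * ψ x) 2 (volume : Measure ℝ)}
      add_mem' := fun {φ ψ} hφ hψ => (memLp_congr_ae (by
        filter_upwards [Lp.coeFn_add φ ψ] with x hx
        rw [hx, Pi.add_apply, Pi.add_apply, mul_add])).mpr (MemLp.add hφ hψ)
      zero_mem' := (memLp_congr_ae (by
        filter_upwards [Lp.coeFn_zero ℂ 2 (volume : Measure ℝ)] with x hx
        simp)).mpr (MemLp.zero (ε := ℂ))
      smul_mem' := fun c ψ hψ => (memLp_congr_ae (by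
        filter_upwards [Lp.coeFn_smul c ψ] with x hx
        simp [hx, mul_left_comm])).mpr (MemLp.const_smul hψ c) }
  toFun :=
    { toFun := fun ψ => MemLp.toLp (fun x => g x * (ψ : Weight) x) ψ.2
      map_add' := fun φ ψ => by
        rw [← MemLp.toLp_add]
        apply MemLp.toLp_congr
        filter_upwards [Lp.coeFn_add (φ : Weight) (ψ : Weight)] with x hx
        rw [Submodule.coe_add, hx, Pi.add_apply, Pi.add_apply, mul_add]
      map_smul' := fun c ψ => by
        rw [RingHom.id_apply, ← MemLp.toLp_const_smul]
        apply MemLp.toLp_congr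
        filter_upwards [Lp.coeFn_smul c (ψ : Weight)] with x hx
        simp [hx, mul_left_comm] }

/-- The position operator `X`, which is also the Hamiltonian of the weight. -/
def positionOp : Weight →ₗ.[ℂ] Weight := mulUnbounded fun x => (x : ℂ)

/-- The momentum operator `P = -iħ d/dx`, i.e. multiplication by `p = 2πħξ` after the Fourier
transform, with domain `{ψ | p ψ̂ ∈ L²}`. -/
def momentumOp (ħ : ℝ) : Weight →ₗ.[ℂ] Weight :=
  let M := mulUnbounded fun ξ => ((2 * Real.pi * ħ * ξ : ℝ) : ℂ)
  let F : Weight →ₗ[ℂ] Weight := fourierW.toLinearEquiv.toLinearMap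
  { domain := M.domain.comap F
    toFun := fourierW.symm.toLinearEquiv.toLinearMap ∘ₗ M.toFun ∘ₗ F.submoduleComap M.domain }

/-- `μ` is the momentum distribution `p ↦ ⟨p|ρ|p⟩` of `ρ`: an integrable nonnegative function such
that `Tr (ρ 1_A(P)) = ∫_A μ` for every Borel set `A`. -/
def IsMomentumDensity (ħ : ℝ) (ρ : Weight →L[ℂ] Weight) (μ : ℝ → ℝ) : Prop :=
  (∀ p, 0 ≤ μ p) ∧ Integrable μ ∧
    ∀ A : Set ℝ, MeasurableSet A →
      HasTrace (ρ ∘L momentumFun ħ (A.indicator 1)) ((∫ p in A, μ p : ℝ) : ℂ)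

/-- The free evolution `exp (-itX/ħ)` of the weight. -/
def weightEvolution (ħ t : ℝ) : Weight →L[ℂ] Weight :=
  mulBounded fun x => Complex.exp (-Complex.I / ħ * t * x)

/-- The density `μ` rescaled by the factor `δ` around `p₀`. -/
def rescale (μ : ℝ → ℝ) (p₀ δ : ℝ) (p : ℝ) : ℝ := 1 / δ * μ ((p - p₀) / δ + p₀)

/-! ### The engine: system and weight -/

section Engine

variable {ι : Type v} [Fintype ι]
  {S : Type u} [NormedAddCommGroup S] [InnerProductSpace ℂ S] [FiniteDimensional ℂ S]
  [CompleteSpace S]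

/-- The Hamiltonian `H_e = H_s ⊗ 1 + 1 ⊗ X` of the engine. -/
def engineHamiltonian (Hs : S →L[ℂ] S) : (S ⊗[ℂ] Weight) →ₗ.[ℂ] (S ⊗[ℂ] Weight) :=
  (Hs.rTensor Weight : (S ⊗[ℂ] Weight) →ₗ[ℂ] (S ⊗[ℂ] Weight)) +ᵥ oneTensor S positionOp

/-- `U_e = ∑ n j, ⟨E_n|V|E_j⟩ |E_n⟩⟨E_j| ⊗ exp (-(i/ħ) (P - p₀) (E_j - E_n))`. -/
def engineUnitary (ħ : ℝ) (b : OrthonormalBasis ι ℂ S) (E : ι → ℝ) (V : S →L[ℂ] S) (p₀ : ℝ) :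
    (S ⊗[ℂ] Weight) →L[ℂ] (S ⊗[ℂ] Weight) :=
  ∑ n, ∑ j, (inner ℂ (b n) (V (b j)) : ℂ) •
    TensorProduct.mapL (rankOne ℂ (b n) (b j))
      (momentumFun ħ fun p => Complex.exp (-Complex.I / ħ * (p - p₀) * (E j - E n)))

/-- `U_s(p) = ∑ n j, exp (-(i/ħ) (p - p₀) (E_j - E_n)) ⟨E_n|V|E_j⟩ |E_n⟩⟨E_j|`. -/
def systemUnitary (ħ : ℝ) (b : OrthonormalBasis ι ℂ S) (E : ι → ℝ) (V : S →L[ℂ] S) (p₀ p : ℝ) :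
    S →L[ℂ] S :=
  ∑ n, ∑ j, (Complex.exp (-Complex.I / ħ * (p - p₀) * (E j - E n)) *
    (inner ℂ (b n) (V (b j)) : ℂ)) • rankOne ℂ (b n) (b j)

/-- The final state `U (ρ_s ⊗ ρ_w) U†` of the engine. -/
def engineState (U : (S ⊗[ℂ] Weight) →L[ℂ] (S ⊗[ℂ] Weight))
    (ρs : S →L[ℂ] S) (ρw : Weight →L[ℂ] Weight) : (S ⊗[ℂ] Weight) →L[ℂ] (S ⊗[ℂ] Weight) :=
  U ∘L TensorProduct.mapL ρs ρw ∘L U.adjoint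

end Engine

end QuantumWeight

end

open QuantumWeight

/-!
In the momentum representation of the weight, `L²(ℝ)` is a direct integral of copies of `ℂ`, and
`U_e` is decomposable: it acts as the unitary `U_s(p)` on the fiber of `S ⊗ L²(ℝ)` at momentum `p`.
`fiberOp` is the map that sends a bounded measurable family `G` of operators of the system to
`∫ G p ⊗ |p⟩⟨p| dp`; it is a `*`-homomorphism (`fiberOp_comp`, `fiberOp_adjoint`, `fiberOp_one`) and
`U_e` is the image of `U_s` (`engineUnitary_eq_fiberOp`). As `U_s(p) = D† V D` for a diagonal unitary
`D`, unitarity of `U_e` and its representation as a weak integral follow. Energy conservation is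
checked term by term: `exp (-(i/ħ) (P - p₀) a)` is, up to a phase, the translation by `a`
(`momentumFun_exp_coeFn`, from the density of Schwartz functions), so that each term of `U_e` gives to
the weight the energy it takes from the system (`commutes_mapL`).

For the statements about states, the square root of a density operator gives a decomposition
`ρ = ∑ k, |v k⟩⟨v k|` with `Tr (A ρ B) = ∑ k, ⟪v k, B A (v k)⟫` for all bounded `A` and `B`
(`IsDensityOperator.exists_decomposition`); this is Parseval's identity for Hilbert–Schmidt operators.
Hence `∑ k, |⟨p|v k⟩|²`, a series that converges in `L¹(ℝ)`, is the momentum distribution of a weight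
state `ρ`, and `Tr (A ρ B) = ∫ f(p) μ(p) dp` whenever `B A = f(P)` (`IsMomentumDensity.hasTrace`).
The matrix elements of the final state of the engine between vectors of the system are finite sums of
operators `f(P) ρ_w g(P)`, so `hasTrace_engineState` computes their traces: summed against `1` this is
the mixture `∫ μ(p) U_s(p) ρ_s U_s(p)† dp`, and traced over the system it shows that the momentum
distribution of the weight is unchanged.

The approximation is then a statement about mixtures of unitary conjugates
(`exists_forall_traceNorm_integral_sub_le`), which follows from the continuity of `U_s` at `p₀`, where
it equals `V`; a rescaled density is concentrated at `p₀`, and any density is the momentum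
distribution of a pure state with wave function `√μ`.
-/

namespace QuantumWeight

universe u v

/-! ### Traces of sandwiched density operators -/

section Trace

variable {H : Type u} [NormedAddCommGroup H] [InnerProductSpace ℂ H]

theorem HasTrace.const_smul {T : H →L[ℂ] H} {c : ℂ} (h : HasTrace T c) (a : ℂ) :
    HasTrace (a • T) (a * c) := fun κ e => by
  simpa [inner_smul_right] using (h κ e).mul_left a

theorem HasTrace.sum {α : Type*} (s : Finset α) {T : α → H →L[ℂ] H} {c : α → ℂ}
    (h : ∀ i ∈ s, HasTrace (T i) (c i)) : HasTrace (∑ i ∈ s, T i) (∑ i ∈ s, c i) := fun κ e => by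
  simpa [inner_sum] using hasSum_sum fun i hi => h i hi κ e

/-- Each of the at most `dim H` nonzero singular values is bounded by the operator norm. -/
theorem traceNorm_le [FiniteDimensional ℂ H] (T : H →L[ℂ] H) :
    traceNorm T ≤ Module.finrank ℂ H * ‖T‖ := by
  have hs : ∀ n, (T : H →ₗ[ℂ] H).singularValues n ≤ ‖T‖ := fun n => by
    rcases lt_or_ge n (Module.finrank ℂ H) with hn | hn
    · obtain ⟨v, hv⟩ := ((T : H →ₗ[ℂ] H).hasEigenvalue_adjoint_comp_self_sq_singularValues
        hn).exists_hasEigenvector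
      have h1 := hv.apply_eq_smul
      have h2 : ‖T v‖ ^ 2 = ((T : H →ₗ[ℂ] H).singularValues n * ‖v‖) ^ 2 := by
        have h3 : inner ℂ v ((LinearMap.adjoint (T : H →ₗ[ℂ] H) ∘ₗ (T : H →ₗ[ℂ] H)) v) =
            inner ℂ (T v) (T v) := by
          rw [LinearMap.comp_apply, LinearMap.adjoint_inner_right]
          rfl
        rw [h1, inner_smul_right, inner_self_eq_norm_sq_to_K, inner_self_eq_norm_sq_to_K] at h3
        rw [mul_pow]
        exact_mod_cast h3.symm
      have h4 := (sq_le_sq₀ (by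
        have := (T : H →ₗ[ℂ] H).singularValues_nonneg n
        positivity) (by positivity)).mp (h2.symm.le.trans
        (pow_le_pow_left₀ (norm_nonneg _) (T.le_opNorm v) 2))
      exact le_of_mul_le_mul_right h4 (norm_pos_iff.mpr hv.2)
    · rw [LinearMap.singularValues_of_finrank_le _ hn]
      exact norm_nonneg _
  rw [traceNorm, Finsupp.sum, LinearMap.support_singularValues]
  calc _ ≤ ∑ n ∈ Finset.range (Module.finrank ℂ (T : H →ₗ[ℂ] H).range), ‖T‖ :=
        Finset.sum_le_sum fun n _ => hs n
    _ ≤ _ := by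
        rw [Finset.sum_const, Finset.card_range, nsmul_eq_mul]
        gcongr
        exact Submodule.finrank_le _

theorem hasSum_norm_sq_inner {κ : Type*} (e : HilbertBasis κ ℂ H) (x : H) :
    HasSum (fun k => ‖inner ℂ (e k) x‖ ^ 2) (‖x‖ ^ 2) := by
  have h := (e.hasSum_inner_mul_inner x x).mapL Complex.reCLM
  simp only [Complex.reCLM_apply, inner_self_eq_norm_sq_to_K] at h
  convert! h using 1
  · ext k
    rw [← inner_conj_symm x, ← Complex.normSq_eq_conj_mul_self, Complex.ofReal_re,
      Complex.normSq_eq_norm_sq]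
  · norm_cast

variable [CompleteSpace H]

theorem HasTrace.unique {T : H →L[ℂ] H} {c c' : ℂ} (h : HasTrace T c) (h' : HasTrace T c') :
    c = c' := by
  obtain ⟨w, e, -⟩ := exists_hilbertBasis ℂ H
  exact (h _ e).unique (h' _ e)

/-- Parseval's identity for the Hilbert–Schmidt inner product of `T` and `S`, computed in one basis
from the adjoints and in another one from the operators themselves. -/
theorem hasSum_inner_adjoint_adjoint {κ κ' : Type*} (e : HilbertBasis κ ℂ H)
    (f : HilbertBasis κ' ℂ H) (T S : H →L[ℂ] H) (hT : Summable fun l => ‖T (f l)‖ ^ 2)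
    (hS : Summable fun l => ‖S (f l)‖ ^ 2) :
    HasSum (fun k => inner ℂ (T.adjoint (e k)) (S.adjoint (e k)))
      (∑' l, inner ℂ (S (f l)) (T (f l))) := by
  have key : ∀ A : H →L[ℂ] H, (Summable fun l => ‖A (f l)‖ ^ 2) →
      Summable fun p : κ' × κ => ‖(inner ℂ (e p.2) (A (f p.1)) : ℂ)‖ ^ 2 := fun A hA => by
    rw [summable_prod_of_nonneg fun _ => by positivity]
    exact ⟨fun l => (hasSum_norm_sq_inner e (A (f l))).summable,
      by simpa only [(hasSum_norm_sq_inner e _).tsum_eq] using hA⟩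
  -- absolute summability of the double series `⟪S f_l, e_k⟫ ⟪e_k, T f_l⟫`, which is then summed in
  -- both orders
  have hF : Summable fun p : κ' × κ =>
      (inner ℂ (S (f p.1)) (e p.2) * inner ℂ (e p.2) (T (f p.1)) : ℂ) := by
    refine Summable.of_norm_bounded ((key S hS).add (key T hT)) fun p => ?_
    rw [norm_mul, ← inner_conj_symm, RCLike.norm_conj]
    nlinarith [sq_nonneg (‖(inner ℂ (e p.2) (S (f p.1)) : ℂ)‖ -
        ‖(inner ℂ (e p.2) (T (f p.1)) : ℂ)‖),
      sq_nonneg ‖(inner ℂ (e p.2) (S (f p.1)) : ℂ)‖, sq_nonneg ‖(inner ℂ (e p.2) (T (f p.1)) : ℂ)‖]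
  have h1 := hF.hasSum.prod_fiberwise fun l => e.hasSum_inner_mul_inner (S (f l)) (T (f l))
  have h2 := ((Equiv.prodComm κ κ').hasSum_iff.mpr hF.hasSum).prod_fiberwise
    (g := fun k => inner ℂ (T.adjoint (e k)) (S.adjoint (e k))) fun k => by
      simp only [Function.comp_def, Equiv.prodComm_apply, Prod.fst_swap, Prod.snd_swap]
      convert! f.hasSum_inner_mul_inner (T.adjoint (e k)) (S.adjoint (e k)) using 2 with l
      rw [ContinuousLinearMap.adjoint_inner_left, ContinuousLinearMap.adjoint_inner_right, mul_comm]
  rwa [h1.tsum_eq]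

theorem exists_adjoint_eq_comp_self_eq {T : H →L[ℂ] H} (hT : T.IsPositive) :
    ∃ R : H →L[ℂ] H, R.adjoint = R ∧ R ∘L R = T :=
  ⟨CFC.sqrt T, ((ContinuousLinearMap.nonneg_iff_isPositive _).mp
    (CFC.sqrt_nonneg T)).isSelfAdjoint.adjoint_eq,
    CFC.sqrt_mul_sqrt_self T ((ContinuousLinearMap.nonneg_iff_isPositive T).mpr hT)⟩

/-- The square root of a density operator has Hilbert–Schmidt norm one. -/
theorem IsDensityOperator.exists_sqrt {ρ : H →L[ℂ] H} (hρ : IsDensityOperator ρ) :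
    ∃ R : H →L[ℂ] H, R.adjoint = R ∧ R ∘L R = ρ ∧
      ∀ (κ : Type u) (f : HilbertBasis κ ℂ H), HasSum (fun k => ‖R (f k)‖ ^ 2) 1 := by
  obtain ⟨R, hRa, hRR⟩ := exists_adjoint_eq_comp_self_eq hρ.1
  refine ⟨R, hRa, hRR, fun κ f => ?_⟩
  have h := (hρ.2 _ f).mapL Complex.reCLM
  simp only [Complex.reCLM_apply, Complex.one_re] at h
  convert! h using 2 with k
  rw [← hRR, ContinuousLinearMap.comp_apply, ← ContinuousLinearMap.adjoint_inner_left, hRa,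
    inner_self_eq_norm_sq_to_K]
  norm_cast

/-- A density operator is a mixture `ρ = ∑ k, |v k⟩⟨v k|` of unnormalized pure states, for instance
`v k = √ρ (e k)` for a Hilbert basis `e`, and the trace of `A ρ B` can be computed from it. -/
theorem IsDensityOperator.exists_decomposition {ρ : H →L[ℂ] H} (hρ : IsDensityOperator ρ) :
    ∃ (κ : Type u) (v : κ → H), HasSum (fun k => ‖v k‖ ^ 2) 1 ∧
      ∀ A B : H →L[ℂ] H, HasTrace (A ∘L ρ ∘L B) (∑' k, inner ℂ (v k) (B (A (v k)))) := by
  obtain ⟨w, f, -⟩ := exists_hilbertBasis ℂ H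
  obtain ⟨R, hRa, hRR, hsum⟩ := hρ.exists_sqrt
  have hbd : ∀ A : H →L[ℂ] H, Summable fun k => ‖(A ∘L R) (f k)‖ ^ 2 := fun A => by
    refine Summable.of_nonneg_of_le (fun _ => by positivity) (fun k => ?_)
      ((hsum _ f).summable.mul_left (‖A‖ ^ 2))
    rw [← mul_pow]
    exact pow_le_pow_left₀ (norm_nonneg _) (A.le_opNorm _) 2
  refine ⟨w, fun k => R (f k), hsum _ f, fun A B κ e => ?_⟩
  convert! hasSum_inner_adjoint_adjoint e f (A ∘L R) (B.adjoint ∘L R) (hbd _) (hbd _) using 1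
  · ext k
    rw [ContinuousLinearMap.adjoint_comp, ContinuousLinearMap.adjoint_comp,
      ContinuousLinearMap.adjoint_adjoint, hRa, ← hRR]
    simp only [ContinuousLinearMap.comp_apply]
    rw [← ContinuousLinearMap.adjoint_inner_left A, ← ContinuousLinearMap.adjoint_inner_left R, hRa]
  · simp [ContinuousLinearMap.adjoint_inner_left]

/-- `Tr (|ψ⟩⟨ψ| A) = ⟪ψ, A ψ⟫`, again by Parseval's identity. -/
theorem hasTrace_rankOne_comp (ψ : H) (A : H →L[ℂ] H) :
    HasTrace (rankOne ℂ ψ ψ ∘L A) (inner ℂ ψ (A ψ)) := fun κ e => by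
  convert! e.hasSum_inner_mul_inner (A.adjoint ψ) ψ using 1
  · ext k
    simp [ContinuousLinearMap.adjoint_inner_left]
  · rw [ContinuousLinearMap.adjoint_inner_left]

/-- The basis of the algebraic trace has to be lifted to the universe of `H`, over which `HasTrace`
quantifies. -/
theorem HasTrace.eq_trace [FiniteDimensional ℂ H] {T : H →L[ℂ] H} {c : ℂ} (h : HasTrace T c) :
    c = (T : H →ₗ[ℂ] H).trace ℂ H := by
  let e := (stdOrthonormalBasis ℂ H).reindex Equiv.ulift.{u}.symm
  refine (h _ e.toHilbertBasis).unique ?_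
  rw [LinearMap.trace_eq_sum_inner _ e]
  simpa using hasSum_fintype fun k => inner ℂ (e k) (T (e k))

/-- For `R = √ρ` and a Hilbert basis `f`,
`‖R x‖² = ∑ k, |⟪R (f k), x⟫|² ≤ ‖x‖² ∑ k, ‖R (f k)‖² = ‖x‖²`. -/
theorem IsDensityOperator.norm_le_one {ρ : H →L[ℂ] H} (hρ : IsDensityOperator ρ) : ‖ρ‖ ≤ 1 := by
  obtain ⟨w, f, -⟩ := exists_hilbertBasis ℂ H
  obtain ⟨R, hRa, hRR, hsum⟩ := hρ.exists_sqrt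
  have hR : ‖R‖ ≤ 1 := R.opNorm_le_bound zero_le_one fun x => by
    rw [one_mul]
    refine (sq_le_sq₀ (norm_nonneg _) (norm_nonneg _)).mp ?_
    refine hasSum_le (fun k => ?_) (hasSum_norm_sq_inner f (R x))
      (by simpa using (hsum _ f).mul_right (‖x‖ ^ 2))
    rw [← ContinuousLinearMap.adjoint_inner_left, hRa, ← mul_pow]
    exact pow_le_pow_left₀ (norm_nonneg _) (norm_inner_le_norm _ _) 2
  calc ‖ρ‖ ≤ ‖R‖ * ‖R‖ := hRR ▸ R.opNorm_comp_le R
    _ ≤ 1 := mul_le_one₀ hR (norm_nonneg _) hR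

end Trace

/-! ### Bounded functions of the momentum operator -/

section MomentumFun

theorem mulBounded_coeFn {g : ℝ → ℂ} (hg : MemLp g ∞) (ψ : Weight) :
    mulBounded g ψ =ᵐ[volume] fun x => g x * ψ x := by
  rw [mulBounded, dif_pos hg]
  refine (ContinuousLinearMap.coeFn_holder _ _ _).trans ?_
  filter_upwards [hg.coeFn_toLp] with x hx
  simp [hx]

theorem memLp_top_comp_const_mul {g : ℝ → ℂ} (hg : MemLp g ∞) {c : ℝ} (hc : c ≠ 0) :
    MemLp (fun x => g (c * x)) ∞ := by
  have hq := Measure.quasiMeasurePreserving_smul (volume : Measure ℝ) hc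
  refine memLp_top_of_bound (hg.1.comp_quasiMeasurePreserving hq) (eLpNorm g ∞ volume).toReal ?_
  have hb : ∀ᵐ x : ℝ, ‖g x‖ ≤ (eLpNorm g ∞ volume).toReal := by
    filter_upwards [ae_le_eLpNormEssSup (f := g) (μ := volume)] with x hx
    rw [← toReal_enorm]
    exact ENNReal.toReal_mono hg.2.ne (by rwa [eLpNorm_exponent_top])
  exact hq.ae hb

variable {ħ : ℝ}

theorem two_pi_mul_pos (hħ : 0 < ħ) : 0 < 2 * Real.pi * ħ := by positivity

theorem fourierW_momentumFun (hħ : 0 < ħ) {g : ℝ → ℂ} (hg : MemLp g ∞) (ψ : Weight) :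
    fourierW (momentumFun ħ g ψ) =ᵐ[volume] fun ξ => g (2 * Real.pi * ħ * ξ) * fourierW ψ ξ := by
  have h : fourierW (momentumFun ħ g ψ) =
      mulBounded (fun ξ => g (2 * Real.pi * ħ * ξ)) (fourierW ψ) := by
    simp [momentumFun]
  rw [h]
  exact mulBounded_coeFn (memLp_top_comp_const_mul hg (two_pi_mul_pos hħ).ne') _

theorem momentumFun_const (hħ : 0 < ħ) (c : ℂ) : momentumFun ħ (fun _ => c) = c • 1 := by
  ext1 ψ
  apply fourierW.injective
  apply Lp.ext
  rw [smul_apply, map_smul, one_apply_eq_self]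
  filter_upwards [fourierW_momentumFun hħ (memLp_top_const c) ψ,
    Lp.coeFn_smul c (fourierW ψ)] with x hx hx'
  rw [hx, hx']
  rfl

theorem momentumFun_comp (hħ : 0 < ħ) {g h : ℝ → ℂ} (hg : MemLp g ∞) (hh : MemLp h ∞) :
    momentumFun ħ g ∘L momentumFun ħ h = momentumFun ħ fun p => g p * h p := by
  ext1 ψ
  apply fourierW.injective
  apply Lp.ext
  filter_upwards [fourierW_momentumFun hħ hg (momentumFun ħ h ψ), fourierW_momentumFun hħ hh ψ,
    fourierW_momentumFun hħ (MemLp.mul' hh hg (r := ∞)) ψ] with x h1 h2 h3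
  rw [ContinuousLinearMap.comp_apply, h1, h2, h3]
  ring

theorem momentumFun_sum (hħ : 0 < ħ) {α : Type*} (s : Finset α) {g : α → ℝ → ℂ}
    (hg : ∀ i ∈ s, MemLp (g i) ∞) :
    momentumFun ħ (fun p => ∑ i ∈ s, g i p) = ∑ i ∈ s, momentumFun ħ (g i) := by
  induction s using Finset.cons_induction with
  | empty => simpa using momentumFun_const hħ 0
  | cons a s ha ih =>
    have hs : ∀ i ∈ s, MemLp (g i) ∞ := fun i hi => hg i (Finset.mem_cons_of_mem hi)
    have ha' := hg a (Finset.mem_cons_self a s)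
    simp_rw [Finset.sum_cons]
    rw [← ih hs]
    ext1 ψ
    apply fourierW.injective
    apply Lp.ext
    rw [add_apply, map_add]
    have hsum : MemLp (fun p => ∑ i ∈ s, g i p) ∞ := memLp_finsetSum s hs
    filter_upwards [fourierW_momentumFun hħ ha' ψ, fourierW_momentumFun hħ hsum ψ,
      fourierW_momentumFun hħ (ha'.add hsum) ψ,
      Lp.coeFn_add (fourierW (momentumFun ħ (g a) ψ))
        (fourierW (momentumFun ħ (fun p => ∑ i ∈ s, g i p) ψ))] with x h1 h2 h3 h4
    rw [h4, Pi.add_apply, h1, h2, ← add_mul]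
    exact h3

theorem momentumFun_const_mul (hħ : 0 < ħ) {g : ℝ → ℂ} (hg : MemLp g ∞) (c : ℂ) :
    momentumFun ħ (fun p => c * g p) = c • momentumFun ħ g := by
  rw [← momentumFun_comp hħ (memLp_top_const c) hg, momentumFun_const hħ]
  rfl

/-- The change of variables `p = 2πħξ` between the momentum and the frequency `ξ`. -/
theorem momentumWave_mul_eq (hħ : 0 < ħ) (g : ℝ → ℂ) (φ ψ : Weight) (p : ℝ) :
    g p * (conj (momentumWave ħ φ p) * momentumWave ħ ψ p) =
      ((2 * Real.pi * ħ)⁻¹ : ℝ) • (fun ξ => inner ℂ (fourierW φ ξ)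
        (g (2 * Real.pi * ħ * ξ) * fourierW ψ ξ)) (p / (2 * Real.pi * ħ)) := by
  have h0 := two_pi_mul_pos hħ
  have hs : (((Real.sqrt (2 * Real.pi * ħ))⁻¹ : ℝ) : ℂ) * ((Real.sqrt (2 * Real.pi * ħ))⁻¹ : ℝ) =
      ((2 * Real.pi * ħ)⁻¹ : ℝ) := by
    rw [← Complex.ofReal_mul, ← mul_inv, Real.mul_self_sqrt h0.le]
  simp only [momentumWave, mul_div_cancel₀ p h0.ne', RCLike.inner_apply, Complex.real_smul, map_mul,
    Complex.conj_ofReal]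
  rw [← hs]
  ring

theorem integrable_momentumWave_mul (hħ : 0 < ħ) {g : ℝ → ℂ} (hg : MemLp g ∞) (φ ψ : Weight) :
    Integrable fun p => g p * (conj (momentumWave ħ φ p) * momentumWave ħ ψ p) := by
  simp_rw [momentumWave_mul_eq hħ]
  have h := (L2.integrable_inner (𝕜 := ℂ) (fourierW φ) (fourierW (momentumFun ħ g ψ))).congr
    (g := fun ξ => inner ℂ (fourierW φ ξ) (g (2 * Real.pi * ħ * ξ) * fourierW ψ ξ)) (by
      filter_upwards [fourierW_momentumFun hħ hg ψ] with x hx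
      rw [hx])
  exact (h.comp_div (two_pi_mul_pos hħ).ne').smul ((2 * Real.pi * ħ)⁻¹ : ℝ)

/-- The matrix elements of `g(P)` in the momentum representation. -/
theorem inner_momentumFun (hħ : 0 < ħ) {g : ℝ → ℂ} (hg : MemLp g ∞) (φ ψ : Weight) :
    inner ℂ φ (momentumFun ħ g ψ) =
      ∫ p, g p * (conj (momentumWave ħ φ p) * momentumWave ħ ψ p) := by
  have h0 := two_pi_mul_pos hħ
  simp_rw [momentumWave_mul_eq hħ]
  rw [integral_smul, Measure.integral_comp_div (fun ξ => (inner ℂ (fourierW φ ξ)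
    (g (2 * Real.pi * ħ * ξ) * fourierW ψ ξ) : ℂ)), abs_of_pos h0, smul_smul,
    inv_mul_cancel₀ h0.ne', one_smul, ← fourierW.inner_map_map, L2.inner_def]
  refine integral_congr_ae ?_
  filter_upwards [fourierW_momentumFun hħ hg ψ] with x hx
  rw [hx]

theorem momentumFun_adjoint (hħ : 0 < ħ) {g : ℝ → ℂ} (hg : MemLp g ∞) :
    (momentumFun ħ g).adjoint = momentumFun ħ fun p => conj (g p) := by
  symm
  rw [ContinuousLinearMap.eq_adjoint_iff]
  intro φ ψ
  rw [← inner_conj_symm, inner_momentumFun hħ (g := fun p => conj (g p)) hg.star,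
    inner_momentumFun hħ hg, ← integral_conj]
  congr 1 with p
  simp only [map_mul, Complex.conj_conj]
  ring

end MomentumFun

/-! ### Translations and the Fourier transform -/

section Translation

/-- The translation `ψ ↦ ψ(· - a)`. -/
noncomputable def translateW (a : ℝ) : Weight →ₗᵢ[ℂ] Weight :=
  Lp.compMeasurePreservingₗᵢ ℂ (fun x => x - a) (measurePreserving_sub_right volume a)

theorem translateW_coeFn (a : ℝ) (ψ : Weight) :
    translateW a ψ =ᵐ[volume] fun x => ψ (x - a) :=
  Lp.coeFn_compMeasurePreserving ψ (measurePreserving_sub_right volume a)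

theorem translateW_toLp (a : ℝ) (f : SchwartzMap ℝ ℂ) :
    translateW a (f.toLp 2) = (f.compSubConstCLM ℂ a).toLp 2 := by
  apply Lp.ext
  have h := (measurePreserving_sub_right (volume : Measure ℝ) a).quasiMeasurePreserving.ae_eq_comp
    (f.coeFn_toLp 2)
  filter_upwards [translateW_coeFn a (f.toLp 2), (f.compSubConstCLM ℂ a).coeFn_toLp 2, h]
    with x h1 h2 h3
  rw [h1, h2]
  exact h3

/-- The character `x ↦ exp (2πiax)`. -/
noncomputable def character (a x : ℝ) : ℂ := Real.fourierChar (a * x)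

theorem memLp_character (a : ℝ) : MemLp (character a) ∞ := by
  refine memLp_top_of_bound ?_ 1 (.of_forall fun x => (Circle.norm_coe _).le)
  unfold character
  fun_prop

/-- Both sides are continuous in `ψ`, and on Schwartz functions the identity is the classical one for
the Fourier integral. -/
theorem fourierW_translateW (a : ℝ) (ψ : Weight) :
    fourierW (translateW a ψ) = mulBounded (character (-a)) (fourierW ψ) := by
  have hc : Continuous fun ψ : Weight => fourierW (translateW a ψ) :=
    fourierW.continuous.comp (translateW a).continuous
  have hc' : Continuous fun ψ : Weight => mulBounded (character (-a)) (fourierW ψ) :=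
    (mulBounded _).continuous.comp fourierW.continuous
  refine congrFun ((SchwartzMap.denseRange_toLpCLM (F := ℂ) (p := 2) (μ := (volume : Measure ℝ))
    ENNReal.ofNat_ne_top).equalizer hc hc' ?_) ψ
  ext1 f
  have hF : ∀ f : SchwartzMap ℝ ℂ, fourierW (f.toLp 2) = (FourierTransform.fourier f).toLp 2 :=
    SchwartzMap.toLp_fourier_eq
  simp only [Function.comp_apply, SchwartzMap.toLpCLM_apply]
  rw [translateW_toLp, hF, hF]
  apply Lp.ext
  filter_upwards [mulBounded_coeFn (memLp_character (-a)) ((FourierTransform.fourier f).toLp 2),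
    SchwartzMap.coeFn_toLp (FourierTransform.fourier f) 2,
    SchwartzMap.coeFn_toLp (FourierTransform.fourier (f.compSubConstCLM ℂ a)) 2] with x h1 h2 h3
  rw [h1, h2, h3, SchwartzMap.fourier_coe, SchwartzMap.fourier_coe]
  refine (congrFun (VectorFourier.fourierIntegral_comp_add_right Real.fourierChar volume (innerₗ ℝ)
    f (-a)) x).trans ?_
  rw [Circle.smul_def, smul_eq_mul, innerₗ_apply_apply, real_inner_comm]
  rfl

/-- The version for the inverse transform; with `ψ` replaced by its Fourier transform, it says that
the Fourier transform turns multiplication by a character into a translation. -/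
theorem fourierW_symm_translateW (a : ℝ) (ψ : Weight) :
    fourierW.symm (translateW a ψ) = mulBounded (character a) (fourierW.symm ψ) := by
  have hc : Continuous fun ψ : Weight => fourierW.symm (translateW a ψ) :=
    fourierW.symm.continuous.comp (translateW a).continuous
  have hc' : Continuous fun ψ : Weight => mulBounded (character a) (fourierW.symm ψ) :=
    (mulBounded _).continuous.comp fourierW.symm.continuous
  refine congrFun ((SchwartzMap.denseRange_toLpCLM (F := ℂ) (p := 2) (μ := (volume : Measure ℝ))
    ENNReal.ofNat_ne_top).equalizer hc hc' ?_) ψ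
  ext1 f
  have hF : ∀ f : SchwartzMap ℝ ℂ,
      fourierW.symm (f.toLp 2) = (FourierTransformInv.fourierInv f).toLp 2 :=
    SchwartzMap.toLp_fourierInv_eq
  simp only [Function.comp_apply, SchwartzMap.toLpCLM_apply]
  rw [translateW_toLp, hF, hF]
  apply Lp.ext
  filter_upwards [mulBounded_coeFn (memLp_character a)
      ((FourierTransformInv.fourierInv f).toLp 2),
    SchwartzMap.coeFn_toLp (FourierTransformInv.fourierInv f) 2,
    SchwartzMap.coeFn_toLp (FourierTransformInv.fourierInv (f.compSubConstCLM ℂ a)) 2]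
    with x h1 h2 h3
  rw [h1, h2, h3, SchwartzMap.fourierInv_coe, SchwartzMap.fourierInv_coe]
  refine (congrFun (VectorFourier.fourierIntegral_comp_add_right Real.fourierChar volume
    (-innerₗ ℝ) f (-a)) x).trans ?_
  rw [Circle.smul_def, smul_eq_mul, LinearMap.neg_apply, LinearMap.neg_apply, innerₗ_apply_apply,
    inner_neg_left, neg_neg, real_inner_comm]
  rfl

end Translation

/-! ### The momentum distribution -/

section MomentumDensity

variable {ħ : ℝ}

theorem conj_mul_momentumWave (ψ : Weight) (p : ℝ) :
    conj (momentumWave ħ ψ p) * momentumWave ħ ψ p = ((‖momentumWave ħ ψ p‖ ^ 2 : ℝ) : ℂ) := by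
  rw [← Complex.normSq_eq_conj_mul_self, Complex.normSq_eq_norm_sq]

theorem integrable_norm_sq_momentumWave (hħ : 0 < ħ) (ψ : Weight) :
    Integrable fun p => ‖momentumWave ħ ψ p‖ ^ 2 := by
  have h := integrable_momentumWave_mul hħ (memLp_top_const (1 : ℂ)) ψ ψ
  simp_rw [conj_mul_momentumWave, one_mul] at h
  exact h.re

theorem integral_norm_sq_momentumWave (hħ : 0 < ħ) (ψ : Weight) :
    ∫ p, ‖momentumWave ħ ψ p‖ ^ 2 = ‖ψ‖ ^ 2 := by
  have h := inner_momentumFun hħ (memLp_top_const (1 : ℂ)) ψ ψ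
  simp_rw [conj_mul_momentumWave, one_mul, momentumFun_const hħ, one_smul, one_apply_eq_self,
    inner_self_eq_norm_sq_to_K, integral_complex_ofReal] at h
  exact Complex.ofReal_injective (by simpa using h.symm)

/-- The density `∑ k, |⟨p|v k⟩|²` of a mixture `ρ = ∑ k, |v k⟩⟨v k|`, summed in `L¹(ℝ)`, governs the
traces of all operators `A ρ B` for which `B A` is a function of the momentum. -/
theorem IsDensityOperator.exists_density {ρ : Weight →L[ℂ] Weight} (hħ : 0 < ħ)
    (hρ : IsDensityOperator ρ) :
    ∃ μ : ℝ → ℝ, (∀ p, 0 ≤ μ p) ∧ Integrable μ ∧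
      ∀ (A B : Weight →L[ℂ] Weight) (f : ℝ → ℂ), MemLp f ∞ → B ∘L A = momentumFun ħ f →
        HasTrace (A ∘L ρ ∘L B) (∫ p, f p * μ p) := by
  obtain ⟨κ, v, hv, htr⟩ := hρ.exists_decomposition
  have hint := fun k => memLp_one_iff_integrable.mpr (integrable_norm_sq_momentumWave hħ (v k))
  -- the series converges in norm since `∫ |⟨p|v k⟩|² dp = ‖v k‖²` is summable in `k`
  let x : κ → Lp ℝ 1 (volume : Measure ℝ) := fun k => (hint k).toLp
  have hx : ∀ k, ‖x k‖ = ‖v k‖ ^ 2 := fun k => by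
    rw [L1.norm_eq_integral_norm, ← integral_norm_sq_momentumWave hħ (v k)]
    refine integral_congr_ae ?_
    filter_upwards [(hint k).coeFn_toLp] with p hp
    rw [hp, Real.norm_of_nonneg (by positivity)]
  have hsum : Summable x := Summable.of_norm (by simpa only [hx] using hv.summable)
  have hnn : 0 ≤ ∑' k, x k := tsum_nonneg fun k => by
    rw [← Lp.coeFn_nonneg]
    filter_upwards [(hint k).coeFn_toLp] with p hp
    rw [hp]
    exact sq_nonneg _
  set X := ∑' k, x k with hX
  -- an element of `L¹` is only nonnegative almost everywhere, while a density is so everywhere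
  have hae : (fun p => max (X p) 0) =ᵐ[volume] X := by
    filter_upwards [(Lp.coeFn_nonneg X).mpr hnn] with p hp
    exact max_eq_left hp
  refine ⟨fun p => max (X p) 0, fun p => le_max_right _ _, (L1.integrable_coeFn X).congr hae.symm,
    fun A B f hf hAB => ?_⟩
  -- integration against `f` is continuous on `L¹`, hence commutes with the sum
  let Λ := ContinuousLinearMap.lpPairing (volume : Measure ℝ) ∞ 1
    (ContinuousLinearMap.lsmul ℝ ℝ (E := ℂ)).flip hf.toLp
  have hΛ : ∀ y : Lp ℝ 1 (volume : Measure ℝ), Λ y = ∫ p, f p * y p := fun y => by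
    rw [ContinuousLinearMap.lpPairing_eq_integral]
    refine integral_congr_ae ?_
    filter_upwards [hf.coeFn_toLp] with p hp
    simp [hp, mul_comm]
  convert! htr A B using 1
  calc ∫ p, f p * ((max (X p) 0 : ℝ) : ℂ) = ∫ p, f p * X p := by
        refine integral_congr_ae ?_
        filter_upwards [hae] with p hp
        rw [hp]
    _ = Λ X := (hΛ X).symm
    _ = ∑' k, Λ (x k) := Λ.map_tsum hsum
    _ = _ := by
        congr 1 with k
        rw [hΛ, ← ContinuousLinearMap.comp_apply, hAB, inner_momentumFun hħ hf]
        refine integral_congr_ae ?_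
        filter_upwards [(hint k).coeFn_toLp] with p hp
        rw [hp, conj_mul_momentumWave]

theorem memLp_top_indicator_one {A : Set ℝ} (hA : MeasurableSet A) :
    MemLp (A.indicator (1 : ℝ → ℂ)) ∞ :=
  (memLp_top_const (1 : ℂ)).indicator hA

theorem integral_indicator_one_mul {A : Set ℝ} (hA : MeasurableSet A) (μ : ℝ → ℝ) :
    ∫ p, A.indicator (1 : ℝ → ℂ) p * μ p = ((∫ p in A, μ p : ℝ) : ℂ) := by
  rw [← integral_complex_ofReal, ← integral_indicator hA]
  congr 1 with p
  by_cases hp : p ∈ A <;> simp [hp]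

theorem IsDensityOperator.exists_isMomentumDensity {ρ : Weight →L[ℂ] Weight} (hħ : 0 < ħ)
    (hρ : IsDensityOperator ρ) : ∃ μ, IsMomentumDensity ħ ρ μ := by
  obtain ⟨μ, hμ0, hμi, hμ⟩ := hρ.exists_density hħ
  refine ⟨μ, hμ0, hμi, fun A hA => ?_⟩
  rw [← integral_indicator_one_mul hA]
  exact hμ 1 _ _ (memLp_top_indicator_one hA) rfl

/-- Since the momentum distribution is unique up to null sets, it determines the traces of all
operators `A ρ B` for which `B A` is a function of the momentum. -/
theorem IsMomentumDensity.hasTrace {ρ : Weight →L[ℂ] Weight} {μ : ℝ → ℝ} (hħ : 0 < ħ)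
    (hρ : IsDensityOperator ρ) (hμ : IsMomentumDensity ħ ρ μ) {A B : Weight →L[ℂ] Weight}
    {f : ℝ → ℂ} (hf : MemLp f ∞) (hAB : B ∘L A = momentumFun ħ f) :
    HasTrace (A ∘L ρ ∘L B) (∫ p, f p * μ p) := by
  obtain ⟨μ', -, hi, hμ'⟩ := hρ.exists_density hħ
  have hae : μ' =ᵐ[volume] μ := by
    refine hi.ae_eq_of_forall_setIntegral_eq _ _ hμ.2.1 fun s hs _ => ?_
    have h := (hμ' 1 _ _ (memLp_top_indicator_one hs) rfl).unique (hμ.2.2 s hs)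
    rw [integral_indicator_one_mul hs] at h
    exact_mod_cast h
  convert! hμ' A B f hf hAB using 1
  refine integral_congr_ae ?_
  filter_upwards [hae] with p hp
  rw [hp]

/-- The total mass is the trace of `ρ f(P)` for `f = 1`, which is `Tr ρ`. -/
theorem IsMomentumDensity.integral_eq_one {ρ : Weight →L[ℂ] Weight} {μ : ℝ → ℝ} (hħ : 0 < ħ)
    (hρ : IsDensityOperator ρ) (hμ : IsMomentumDensity ħ ρ μ) : ∫ p, μ p = 1 := by
  have h := hμ.hasTrace hħ hρ (A := 1) (B := 1) (memLp_top_const (1 : ℂ))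
    (by rw [momentumFun_const hħ, one_smul]; rfl)
  simp_rw [one_mul, integral_complex_ofReal] at h
  exact_mod_cast h.unique hρ.2

/-- The pure state whose momentum wave function is `√μ` has the momentum distribution `μ`. -/
theorem exists_isMomentumDensity_eq (hħ : 0 < ħ) {μ : ℝ → ℝ} (h0 : ∀ p, 0 ≤ μ p)
    (hi : Integrable μ) (h1 : ∫ p, μ p = 1) :
    ∃ ρ : Weight →L[ℂ] Weight, IsDensityOperator ρ ∧ IsMomentumDensity ħ ρ μ := by
  have hc := two_pi_mul_pos hħ
  set c := 2 * Real.pi * ħ with hcdef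
  have hm : MemLp (fun ξ => ((Real.sqrt c * Real.sqrt (μ (c * ξ)) : ℝ) : ℂ)) 2 := by
    have hi' := (hi.comp_mul_left' hc.ne')
    have hmeas : AEStronglyMeasurable (fun ξ => ((Real.sqrt c * Real.sqrt (μ (c * ξ)) : ℝ) : ℂ))
        volume :=
      (Complex.continuous_ofReal.comp_aestronglyMeasurable
        ((Real.continuous_sqrt.comp_aestronglyMeasurable hi'.1).const_mul _))
    rw [memLp_two_iff_integrable_sq_norm hmeas]
    refine (hi'.const_mul c).congr (.of_forall fun ξ => ?_)
    simp only [Complex.norm_real, Real.norm_eq_abs, sq_abs, mul_pow, Real.sq_sqrt hc.le,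
      Real.sq_sqrt (h0 _)]
  set ψ := fourierW.symm hm.toLp with hψ
  have hw : ∀ᵐ p, ‖momentumWave ħ ψ p‖ ^ 2 = μ p := by
    have h := (Measure.quasiMeasurePreserving_smul (volume : Measure ℝ) (inv_ne_zero hc.ne')).ae
      hm.coeFn_toLp
    filter_upwards [h] with p hp
    have hp' : (hm.toLp : Weight) (p / c) = ((Real.sqrt c * Real.sqrt (μ p) : ℝ) : ℂ) := by
      rw [div_eq_inv_mul, ← smul_eq_mul, hp, smul_eq_mul, mul_inv_cancel_left₀ hc.ne']
    rw [momentumWave, hψ, LinearIsometryEquiv.apply_symm_apply, hp', ← Complex.ofReal_mul,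
      Complex.norm_real, Real.norm_eq_abs, sq_abs, ← hcdef,
      inv_mul_cancel_left₀ (Real.sqrt_pos.mpr hc).ne', Real.sq_sqrt (h0 p)]
  have hval : ∀ f : ℝ → ℂ, MemLp f ∞ → inner ℂ ψ (momentumFun ħ f ψ) = ∫ p, f p * μ p :=
    fun f hf => by
      rw [inner_momentumFun hħ hf]
      refine integral_congr_ae ?_
      filter_upwards [hw] with p hp
      rw [conj_mul_momentumWave, hp]
  refine ⟨rankOne ℂ ψ ψ, ⟨isPositive_rankOne_self ψ, ?_⟩, h0, hi, fun A hA => ?_⟩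
  · have h := hasTrace_rankOne_comp ψ (momentumFun ħ fun _ => 1)
    rw [hval _ (memLp_top_const 1)] at h
    simp_rw [one_mul, integral_complex_ofReal, h1, momentumFun_const hħ, one_smul] at h
    exact h
  · rw [← integral_indicator_one_mul hA, ← hval _ (memLp_top_indicator_one hA)]
    exact hasTrace_rankOne_comp ψ _

end MomentumDensity

/-! ### The free evolution of the weight -/

section Evolution

theorem mulBounded_comp {g h : ℝ → ℂ} (hg : MemLp g ∞) (hh : MemLp h ∞) :
    mulBounded g ∘L mulBounded h = mulBounded fun x => g x * h x := by
  ext1 ψ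
  apply Lp.ext
  filter_upwards [mulBounded_coeFn hg (mulBounded h ψ), mulBounded_coeFn hh ψ,
    mulBounded_coeFn (MemLp.mul' hh hg (r := ∞)) ψ] with x h1 h2 h3
  rw [ContinuousLinearMap.comp_apply, h1, h2, h3]
  ring

theorem mulBounded_one : mulBounded (fun _ => 1) = 1 := by
  ext1 ψ
  apply Lp.ext
  filter_upwards [mulBounded_coeFn (memLp_top_const (1 : ℂ)) ψ] with x hx
  rw [hx, one_mul, one_apply_eq_self]

theorem mulBounded_adjoint {g : ℝ → ℂ} (hg : MemLp g ∞) :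
    (mulBounded g).adjoint = mulBounded fun x => conj (g x) := by
  symm
  rw [ContinuousLinearMap.eq_adjoint_iff]
  intro φ ψ
  rw [L2.inner_def, L2.inner_def]
  refine integral_congr_ae ?_
  filter_upwards [mulBounded_coeFn hg ψ,
    mulBounded_coeFn (g := fun x => conj (g x)) hg.star φ] with x h1 h2
  rw [h1, h2, RCLike.inner_apply, RCLike.inner_apply, map_mul, Complex.conj_conj]
  ring

theorem mulBounded_character_mem_unitary (a : ℝ) :
    mulBounded (character a) ∈ unitary (Weight →L[ℂ] Weight) := by
  have h : ∀ x, conj (character a x) * character a x = 1 := fun x => by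
    rw [← Complex.normSq_eq_conj_mul_self, Complex.normSq_eq_norm_sq, character, Circle.norm_coe]
    simp
  rw [Unitary.mem_iff, ContinuousLinearMap.star_eq_adjoint,
    mulBounded_adjoint (memLp_character a)]
  have hs : MemLp (fun x => conj (character a x)) ∞ := (memLp_character a).star
  constructor
  · rw [ContinuousLinearMap.mul_def, mulBounded_comp hs (memLp_character a)]
    simp_rw [h, mulBounded_one]
  · rw [ContinuousLinearMap.mul_def, mulBounded_comp (memLp_character a) hs]
    simp_rw [mul_comm (character a _), h, mulBounded_one]

variable {ħ : ℝ}

theorem weightEvolution_eq (hħ : 0 < ħ) (t : ℝ) :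
    weightEvolution ħ t = mulBounded (character (-(t / (2 * Real.pi * ħ)))) := by
  unfold weightEvolution character
  congr 1 with x
  rw [Real.fourierChar_apply]
  congr 1
  have : (ħ : ℂ) ≠ 0 := by exact_mod_cast hħ.ne'
  have : (Real.pi : ℂ) ≠ 0 := by exact_mod_cast Real.pi_ne_zero
  push_cast
  field_simp

theorem momentumWave_weightEvolution (hħ : 0 < ħ) (t : ℝ) (ψ : Weight) :
    momentumWave ħ (weightEvolution ħ t ψ) =ᵐ[volume] fun p => momentumWave ħ ψ (p + t) := by
  have h0 := two_pi_mul_pos hħ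
  have h1 : fourierW (weightEvolution ħ t ψ) =
      translateW (-(t / (2 * Real.pi * ħ))) (fourierW ψ) := by
    rw [weightEvolution_eq hħ, ← fourierW.symm.injective.eq_iff, fourierW_symm_translateW,
      LinearIsometryEquiv.symm_apply_apply, LinearIsometryEquiv.symm_apply_apply]
  have h2 := (Measure.quasiMeasurePreserving_smul (volume : Measure ℝ) (inv_ne_zero h0.ne')).ae
    (translateW_coeFn (-(t / (2 * Real.pi * ħ))) (fourierW ψ))
  filter_upwards [h2] with p hp
  rw [momentumWave, momentumWave, h1, div_eq_inv_mul p, ← smul_eq_mul (_⁻¹), hp, smul_eq_mul]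
  congr 2
  field_simp
  ring

/-- The free evolution translates the momentum, in the Heisenberg picture. -/
theorem weightEvolution_conj_momentumFun (hħ : 0 < ħ) (t : ℝ) {f : ℝ → ℂ} (hf : MemLp f ∞) :
    (weightEvolution ħ t).adjoint ∘L momentumFun ħ f ∘L weightEvolution ħ t =
      momentumFun ħ fun p => f (p - t) := by
  have hf' : MemLp (fun p => f (p - t)) ∞ :=
    hf.comp_measurePreserving (measurePreserving_sub_right volume t)
  ext1 ψ
  refine ext_inner_left ℂ fun φ => ?_
  rw [ContinuousLinearMap.comp_apply, ContinuousLinearMap.comp_apply,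
    ContinuousLinearMap.adjoint_inner_right, inner_momentumFun hħ hf, inner_momentumFun hħ hf',
    ← integral_add_right_eq_self
      (fun p => f (p - t) * (conj (momentumWave ħ φ p) * momentumWave ħ ψ p)) t]
  refine integral_congr_ae ?_
  filter_upwards [momentumWave_weightEvolution hħ t φ, momentumWave_weightEvolution hħ t ψ]
    with p h1 h2
  rw [h1, h2, add_sub_cancel_right]

/-- With `W` the free evolution, `Tr (W ρ W† 1_A(P)) = Tr (ρ 1_A(P - t)) = ∫_A μ(p + t) dp`. -/
theorem IsMomentumDensity.weightEvolution_conj {ρ : Weight →L[ℂ] Weight} {μ : ℝ → ℝ} (hħ : 0 < ħ)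
    (hρ : IsDensityOperator ρ) (hμ : IsMomentumDensity ħ ρ μ) (t : ℝ) :
    IsMomentumDensity ħ (weightEvolution ħ t ∘L ρ ∘L (weightEvolution ħ t).adjoint)
      (fun p => μ (p + t)) := by
  refine ⟨fun p => hμ.1 _, hμ.2.1.comp_add_right t, fun A hA => ?_⟩
  have hf := memLp_top_indicator_one hA
  have hf' : MemLp (fun p => A.indicator (1 : ℝ → ℂ) (p - t)) ∞ :=
    hf.comp_measurePreserving (measurePreserving_sub_right volume t)
  have h := hμ.hasTrace hħ hρ (A := weightEvolution ħ t)
    (B := (weightEvolution ħ t).adjoint ∘L momentumFun ħ (A.indicator 1)) hf'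
    (by rw [ContinuousLinearMap.comp_assoc, weightEvolution_conj_momentumFun hħ t hf])
  rw [← integral_add_right_eq_self _ t] at h
  simp_rw [add_sub_cancel_right] at h
  rw [integral_indicator_one_mul hA fun p => μ (p + t)] at h
  rwa [ContinuousLinearMap.comp_assoc, ContinuousLinearMap.comp_assoc]

end Evolution

/-! ### Commutation with position and momentum -/

section Commutation

variable {ħ : ℝ}

/-- `exp (-(i/ħ) (P - p₀) a)` is, up to a phase, the translation by `a`. -/
theorem momentumFun_exp_coeFn (hħ : 0 < ħ) (p₀ a : ℝ) (ψ : Weight) :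
    momentumFun ħ (fun p => Complex.exp (-Complex.I / ħ * (p - p₀) * a)) ψ =ᵐ[volume]
      fun x => Complex.exp (Complex.I / ħ * p₀ * a) * ψ (x - a) := by
  have hc : (fun ξ : ℝ => Complex.exp (-Complex.I / ħ * ((2 * Real.pi * ħ * ξ : ℝ) - p₀) * a)) =
      fun ξ => Complex.exp (Complex.I / ħ * p₀ * a) * character (-a) ξ := by
    ext ξ
    rw [character, Real.fourierChar_apply, ← Complex.exp_add]
    congr 1
    have : (ħ : ℂ) ≠ 0 := by exact_mod_cast hħ.ne'
    push_cast
    field_simp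
    ring
  have h : momentumFun ħ (fun p => Complex.exp (-Complex.I / ħ * (p - p₀) * a)) ψ =
      Complex.exp (Complex.I / ħ * p₀ * a) • translateW a ψ := by
    apply fourierW.injective
    rw [map_smul, fourierW_translateW]
    have h1 : fourierW (momentumFun ħ (fun p => Complex.exp (-Complex.I / ħ * (p - p₀) * a)) ψ) =
        mulBounded (fun ξ => Complex.exp (Complex.I / ħ * p₀ * a) * character (-a) ξ)
          (fourierW ψ) := by
      rw [← hc]
      simp [momentumFun]
    rw [h1]
    apply Lp.ext
    filter_upwards [mulBounded_coeFn ((memLp_character (-a)).const_mul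
        (Complex.exp (Complex.I / ħ * p₀ * a))) (fourierW ψ),
      mulBounded_coeFn (memLp_character (-a)) (fourierW ψ),
      Lp.coeFn_smul (Complex.exp (Complex.I / ħ * p₀ * a))
        (mulBounded (character (-a)) (fourierW ψ))] with ξ h2 h3 h4
    rw [h2, h4, Pi.smul_apply, h3, smul_eq_mul, mul_assoc]
  rw [h]
  filter_upwards [Lp.coeFn_smul (Complex.exp (Complex.I / ħ * p₀ * a)) (translateW a ψ),
    translateW_coeFn a ψ] with x h1 h2
  rw [h1, Pi.smul_apply, h2, smul_eq_mul]

/-- A translation by `a` maps the domain of the position operator into itself, and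
`X T = T X + a T` there. -/
theorem positionOp_momentumFun_exp (hħ : 0 < ħ) (p₀ a : ℝ) (ψ : positionOp.domain) :
    ∃ h : momentumFun ħ (fun p => Complex.exp (-Complex.I / ħ * (p - p₀) * a)) ψ ∈
        positionOp.domain,
      positionOp ⟨_, h⟩ =
        momentumFun ħ (fun p => Complex.exp (-Complex.I / ħ * (p - p₀) * a)) (positionOp ψ) +
        (a : ℂ) • momentumFun ħ (fun p => Complex.exp (-Complex.I / ħ * (p - p₀) * a)) ψ := by
  set T := momentumFun ħ (fun p => Complex.exp (-Complex.I / ħ * (p - p₀) * a)) with hT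
  have hψ : MemLp (fun x : ℝ => (x : ℂ) * (ψ : Weight) x) 2 := ψ.2
  have hXψ : positionOp ψ = hψ.toLp := rfl
  have hsub := (measurePreserving_sub_right (volume : Measure ℝ) a).quasiMeasurePreserving.ae
    hψ.coeFn_toLp
  have key : (fun x : ℝ => (x : ℂ) * T ψ x) =ᵐ[volume]
      (T (positionOp ψ) + (a : ℂ) • T ψ : Weight) := by
    filter_upwards [momentumFun_exp_coeFn hħ p₀ a ψ, momentumFun_exp_coeFn hħ p₀ a (positionOp ψ),
      hsub, Lp.coeFn_add (T (positionOp ψ)) ((a : ℂ) • T ψ), Lp.coeFn_smul (a : ℂ) (T ψ)]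
      with x h1 h2 h3 h4 h5
    rw [h4, Pi.add_apply, h5, Pi.smul_apply, h1, h2, hXψ, h3, smul_eq_mul]
    push_cast
    ring
  have hmem : MemLp (fun x : ℝ => (x : ℂ) * T ψ x) 2 := (memLp_congr_ae key).mpr (Lp.memLp _)
  refine ⟨hmem, Lp.ext ?_⟩
  exact hmem.coeFn_toLp.trans key

theorem commutes_momentumFun_momentumOp (hħ : 0 < ħ) {g : ℝ → ℂ} (hg : MemLp g ∞) :
    Commutes (momentumFun ħ g) (momentumOp ħ) := by
  intro ψ
  have hψ : MemLp (fun ξ : ℝ => ((2 * Real.pi * ħ * ξ : ℝ) : ℂ) * fourierW ψ ξ) 2 := ψ.2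
  have hPψ : fourierW (momentumOp ħ ψ) = hψ.toLp := fourierW.apply_symm_apply _
  have key : (fun ξ : ℝ => ((2 * Real.pi * ħ * ξ : ℝ) : ℂ) * fourierW (momentumFun ħ g ψ) ξ)
      =ᵐ[volume] fourierW (momentumFun ħ g (momentumOp ħ ψ)) := by
    filter_upwards [fourierW_momentumFun hħ hg ψ, fourierW_momentumFun hħ hg (momentumOp ħ ψ),
      hψ.coeFn_toLp] with ξ h1 h2 h3
    rw [h1, h2, hPψ, h3]
    ring
  have hmem : MemLp (fun ξ : ℝ => ((2 * Real.pi * ħ * ξ : ℝ) : ℂ) *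
      fourierW (momentumFun ħ g ψ) ξ) 2 := (memLp_congr_ae key).mpr (Lp.memLp _)
  refine ⟨hmem, fourierW.injective (Lp.ext ?_)⟩
  have h : fourierW (momentumOp ħ ⟨momentumFun ħ g ψ, hmem⟩) = hmem.toLp :=
    fourierW.apply_symm_apply _
  rw [h]
  exact hmem.coeFn_toLp.trans key

end Commutation

/-! ### Operators that are decomposable along the momentum -/

section Fiber

variable {ι : Type v} [Fintype ι]
  {S : Type u} [NormedAddCommGroup S] [InnerProductSpace ℂ S]

theorem tensor_clm_ext {T T' : (S ⊗[ℂ] Weight) →L[ℂ] (S ⊗[ℂ] Weight)}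
    (h : ∀ s ψ, T (s ⊗ₜ ψ) = T' (s ⊗ₜ ψ)) : T = T' := by
  ext x
  induction x using TensorProduct.induction_on with
  | zero => rw [map_zero, map_zero]
  | add x y hx hy => rw [map_add, map_add, hx, hy]
  | tmul s ψ => exact h s ψ

theorem adjoint_mkL_comp_mapL_comp_mkL [FiniteDimensional ℂ S]
    (ρs : S →L[ℂ] S) (ρw : Weight →L[ℂ] Weight) (s t : S) :
    (TensorProduct.mkL ℂ S Weight s).adjoint ∘L TensorProduct.mapL ρs ρw ∘L
      TensorProduct.mkL ℂ S Weight t = (inner ℂ s (ρs t) : ℂ) • ρw := by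
  ext1 ψ
  refine ext_inner_left ℂ fun φ => ?_
  simp [ContinuousLinearMap.adjoint_inner_right, TensorProduct.mkL_apply_apply,
    TensorProduct.inner_tmul, inner_smul_right]

variable [CompleteSpace S]

theorem memLp_top_inner_apply {G : ℝ → S →L[ℂ] S} (hG : MemLp G ∞) (s t : S) :
    MemLp (fun p => (inner ℂ s (G p t) : ℂ)) ∞ :=
  ((innerSL ℂ s) ∘L (ContinuousLinearMap.apply ℂ S t)).comp_memLp' hG

theorem memLp_top_adjoint {G : ℝ → S →L[ℂ] S} (hG : MemLp G ∞) :
    MemLp (fun p => (G p).adjoint) ∞ := by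
  simp_rw [← ContinuousLinearMap.star_eq_adjoint]
  exact hG.star

theorem memLp_top_comp {G G' : ℝ → S →L[ℂ] S} (hG : MemLp G ∞) (hG' : MemLp G' ∞) :
    MemLp (fun p => G p ∘L G' p) ∞ :=
  (ContinuousLinearMap.compL ℂ S S S).memLp_of_bilin ∞ hG hG'

theorem sum_inner_mul_inner_apply (b : OrthonormalBasis ι ℂ S) (A B : S →L[ℂ] S) (s t : S) :
    ∑ n, (inner ℂ s (A (b n)) * inner ℂ (b n) (B t) : ℂ) = inner ℂ s (A (B t)) := by
  simp_rw [← ContinuousLinearMap.adjoint_inner_left A]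
  exact b.sum_inner_mul_inner _ _

variable {ħ : ℝ}

/-- The operator `∫ G p ⊗ |p⟩⟨p| dp` on `S ⊗ L²(ℝ)` for an essentially bounded family `G`, written as
a matrix of functions of the momentum in an orthonormal basis of `S`. -/
noncomputable def fiberOp (ħ : ℝ) (b : OrthonormalBasis ι ℂ S) (G : ℝ → S →L[ℂ] S) :
    (S ⊗[ℂ] Weight) →L[ℂ] (S ⊗[ℂ] Weight) :=
  ∑ n, ∑ j, TensorProduct.mapL (rankOne ℂ (b n) (b j))
    (momentumFun ħ fun p => inner ℂ (b n) (G p (b j)))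

variable (b : OrthonormalBasis ι ℂ S)

theorem fiberOp_tmul (hħ : 0 < ħ) {G : ℝ → S →L[ℂ] S} (hG : MemLp G ∞) (s : S) (ψ : Weight) :
    fiberOp ħ b G (s ⊗ₜ ψ) = ∑ n, b n ⊗ₜ momentumFun ħ (fun p => inner ℂ (b n) (G p s)) ψ := by
  have h : ∀ n, momentumFun ħ (fun p => inner ℂ (b n) (G p s)) =
      ∑ j, (inner ℂ (b j) s : ℂ) • momentumFun ħ (fun p => inner ℂ (b n) (G p (b j))) := fun n => by
    simp_rw [← momentumFun_const_mul hħ (memLp_top_inner_apply hG _ _)]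
    rw [← momentumFun_sum hħ _ fun j _ => (memLp_top_inner_apply hG _ _).const_mul _]
    congr 1 with p
    conv_lhs => rw [← b.sum_repr' s]
    simp only [map_sum, map_smul, inner_sum, inner_smul_right]
  simp only [fiberOp, sum_apply, TensorProduct.mapL_tmul, rankOne_apply, h, tmul_sum, smul_apply,
    tmul_smul, smul_tmul']

theorem fiberOp_comp (hħ : 0 < ħ) {G G' : ℝ → S →L[ℂ] S} (hG : MemLp G ∞) (hG' : MemLp G' ∞) :
    fiberOp ħ b G ∘L fiberOp ħ b G' = fiberOp ħ b fun p => G p ∘L G' p := by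
  refine tensor_clm_ext fun s ψ => ?_
  rw [ContinuousLinearMap.comp_apply, fiberOp_tmul b hħ hG', map_sum,
    fiberOp_tmul b hħ (memLp_top_comp hG hG')]
  simp_rw [fiberOp_tmul b hħ hG]
  rw [Finset.sum_comm]
  refine Finset.sum_congr rfl fun k _ => ?_
  rw [← tmul_sum]
  congr 1
  simp_rw [← ContinuousLinearMap.comp_apply, momentumFun_comp hħ (memLp_top_inner_apply hG _ _)
    (memLp_top_inner_apply hG' _ _)]
  rw [← sum_apply, ← momentumFun_sum hħ _ fun n _ =>
    MemLp.mul' (memLp_top_inner_apply hG' _ _) (memLp_top_inner_apply hG _ _)]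
  simp_rw [sum_inner_mul_inner_apply, ContinuousLinearMap.comp_apply]

theorem fiberOp_one (hħ : 0 < ħ) : fiberOp ħ b (fun _ => 1) = 1 := by
  refine tensor_clm_ext fun s ψ => ?_
  rw [fiberOp_tmul b hħ (memLp_top_const 1)]
  simp_rw [momentumFun_const hħ, one_apply_eq_self, smul_apply, one_apply_eq_self,
    ← smul_tmul, ← sum_tmul, b.sum_repr' s]

theorem fiberOp_comp_mkL (hħ : 0 < ħ) {G : ℝ → S →L[ℂ] S} (hG : MemLp G ∞) (a : S) :
    fiberOp ħ b G ∘L TensorProduct.mkL ℂ S Weight a =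
      ∑ n, TensorProduct.mkL ℂ S Weight (b n) ∘L
        momentumFun ħ (fun p => inner ℂ (b n) (G p a)) := by
  ext1 ψ
  rw [ContinuousLinearMap.comp_apply, TensorProduct.mkL_apply_apply, fiberOp_tmul b hħ hG,
    sum_apply]
  rfl

theorem inner_tmul_fiberOp_tmul (hħ : 0 < ħ) {G : ℝ → S →L[ℂ] S} (hG : MemLp G ∞) (a a' : S)
    (φ ψ : Weight) :
    inner ℂ (a ⊗ₜ[ℂ] φ) (fiberOp ħ b G (a' ⊗ₜ[ℂ] ψ)) =
      ∫ p : ℝ, inner ℂ a (G p a') * (conj (momentumWave ħ φ p) * momentumWave ħ ψ p) := by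
  rw [← inner_momentumFun hħ (memLp_top_inner_apply hG a a'), fiberOp_tmul b hħ hG, inner_sum]
  simp_rw [TensorProduct.inner_tmul, ← inner_smul_right, ← inner_sum, ← smul_apply, ← sum_apply,
    ← momentumFun_const_mul hħ (memLp_top_inner_apply hG _ _)]
  rw [← momentumFun_sum hħ _ fun n _ => (memLp_top_inner_apply hG _ _).const_mul _]
  simp_rw [b.sum_inner_mul_inner]

variable [FiniteDimensional ℂ S]

/-- Together with `fiberOp_comp` and `fiberOp_one`: `G ↦ ∫ G p ⊗ |p⟩⟨p| dp` is a `*`-homomorphism on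
bounded measurable families, so that it maps families of unitaries to unitaries. -/
theorem fiberOp_adjoint (hħ : 0 < ħ) {G : ℝ → S →L[ℂ] S} (hG : MemLp G ∞) :
    (fiberOp ħ b G).adjoint = fiberOp ħ b fun p => (G p).adjoint := by
  simp only [fiberOp, map_sum, TensorProduct.adjoint_mapL, adjoint_rankOne,
    momentumFun_adjoint hħ (memLp_top_inner_apply hG _ _), inner_conj_symm,
    ContinuousLinearMap.adjoint_inner_right]
  exact Finset.sum_comm

theorem fiberOp_mem_unitary (hħ : 0 < ħ) {G : ℝ → S →L[ℂ] S} (hG : MemLp G ∞)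
    (hu : ∀ p, G p ∈ unitary (S →L[ℂ] S)) :
    fiberOp ħ b G ∈ unitary ((S ⊗[ℂ] Weight) →L[ℂ] (S ⊗[ℂ] Weight)) := by
  rw [Unitary.mem_iff, ContinuousLinearMap.star_eq_adjoint, fiberOp_adjoint b hħ hG,
    ContinuousLinearMap.mul_def, ContinuousLinearMap.mul_def,
    fiberOp_comp b hħ (memLp_top_adjoint hG) hG, fiberOp_comp b hħ hG (memLp_top_adjoint hG),
    ← fiberOp_one b hħ]
  constructor <;> congr 1 with p : 1
  · exact Unitary.star_mul_self_of_mem (hu p)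
  · exact Unitary.mul_star_self_of_mem (hu p)

theorem adjoint_mkL_comp_fiberOp (hħ : 0 < ħ) {G : ℝ → S →L[ℂ] S} (hG : MemLp G ∞) (a : S) :
    (TensorProduct.mkL ℂ S Weight a).adjoint ∘L fiberOp ħ b G =
      ∑ n, momentumFun ħ (fun p => inner ℂ a (G p (b n))) ∘L
        (TensorProduct.mkL ℂ S Weight (b n)).adjoint := by
  have h := congrArg ContinuousLinearMap.adjoint (fiberOp_comp_mkL b hħ (memLp_top_adjoint hG) a)
  rw [ContinuousLinearMap.adjoint_comp, fiberOp_adjoint b hħ (memLp_top_adjoint hG), map_sum] at h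
  simp_rw [ContinuousLinearMap.adjoint_adjoint] at h
  rw [h]
  refine Finset.sum_congr rfl fun n _ => ?_
  rw [ContinuousLinearMap.adjoint_comp,
    momentumFun_adjoint hħ (memLp_top_inner_apply (memLp_top_adjoint hG) _ _)]
  simp_rw [inner_conj_symm, ContinuousLinearMap.adjoint_inner_left]

/-- The matrix elements, between two vectors of the system, of the final state of the engine. -/
theorem adjoint_mkL_comp_engineState_comp_mkL (hħ : 0 < ħ) {G : ℝ → S →L[ℂ] S} (hG : MemLp G ∞)
    (ρs : S →L[ℂ] S) (ρw : Weight →L[ℂ] Weight) (a a' : S) :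
    (TensorProduct.mkL ℂ S Weight a).adjoint ∘L engineState (fiberOp ħ b G) ρs ρw ∘L
      TensorProduct.mkL ℂ S Weight a' =
      ∑ n, ∑ m, (inner ℂ (b n) (ρs (b m)) : ℂ) •
        (momentumFun ħ (fun p => inner ℂ a (G p (b n))) ∘L ρw ∘L
          momentumFun ħ (fun p => inner ℂ (b m) ((G p).adjoint a'))) := by
  have h : (TensorProduct.mkL ℂ S Weight a).adjoint ∘L engineState (fiberOp ħ b G) ρs ρw ∘L
      TensorProduct.mkL ℂ S Weight a' =
      ((TensorProduct.mkL ℂ S Weight a).adjoint ∘L fiberOp ħ b G) ∘L TensorProduct.mapL ρs ρw ∘L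
        ((fiberOp ħ b fun p => (G p).adjoint) ∘L TensorProduct.mkL ℂ S Weight a') := by
    rw [engineState, fiberOp_adjoint b hħ hG]
    simp only [ContinuousLinearMap.comp_assoc]
  rw [h, adjoint_mkL_comp_fiberOp b hħ hG, fiberOp_comp_mkL b hħ (memLp_top_adjoint hG)]
  simp_rw [ContinuousLinearMap.comp_finsetSum, ContinuousLinearMap.finsetSum_comp]
  rw [Finset.sum_comm]
  refine Finset.sum_congr rfl fun n _ => Finset.sum_congr rfl fun m _ => ?_
  rw [← ContinuousLinearMap.comp_smul, ← ContinuousLinearMap.smul_comp,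
    ← adjoint_mkL_comp_mapL_comp_mkL]
  simp only [ContinuousLinearMap.comp_assoc]

/-- The joint statistics of the system and of the momentum of the weight in the final state. -/
theorem hasTrace_engineState (hħ : 0 < ħ) {G : ℝ → S →L[ℂ] S} (hG : MemLp G ∞)
    (ρs : S →L[ℂ] S) {ρw : Weight →L[ℂ] Weight} {μ : ℝ → ℝ} (hρw : IsDensityOperator ρw)
    (hμ : IsMomentumDensity ħ ρw μ) {f : ℝ → ℂ} (hf : MemLp f ∞) (a a' : S) :
    HasTrace (((TensorProduct.mkL ℂ S Weight a).adjoint ∘L engineState (fiberOp ħ b G) ρs ρw ∘L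
      TensorProduct.mkL ℂ S Weight a') ∘L momentumFun ħ f)
      (∫ p, inner ℂ a ((G p ∘L ρs ∘L (G p).adjoint) a') * f p * μ p) := by
  have hA : ∀ n, MemLp (fun p => (inner ℂ a (G p (b n)) : ℂ)) ∞ := fun n =>
    memLp_top_inner_apply hG _ _
  have hB : ∀ m, MemLp (fun p => (inner ℂ (b m) ((G p).adjoint a') : ℂ)) ∞ := fun m =>
    memLp_top_inner_apply (memLp_top_adjoint hG) _ _
  have hC : ∀ n m, MemLp (fun p => (inner ℂ (b m) ((G p).adjoint a') * f p *
      inner ℂ a (G p (b n)) : ℂ)) ∞ := fun n m => (hA n).mul' (hf.mul' (hB m) (r := ∞))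
  have hint : ∀ n m, Integrable fun p => (inner ℂ (b m) ((G p).adjoint a') * f p *
      inner ℂ a (G p (b n)) : ℂ) * μ p := fun n m =>
    memLp_one_iff_integrable.mp
      ((memLp_one_iff_integrable.mpr hμ.2.1.ofReal).mul' (hC n m))
  have hval : ∫ p, inner ℂ a ((G p ∘L ρs ∘L (G p).adjoint) a') * f p * μ p =
      ∑ n, ∑ m, (inner ℂ (b n) (ρs (b m)) : ℂ) * ∫ p, (inner ℂ (b m) ((G p).adjoint a') * f p *
        inner ℂ a (G p (b n)) : ℂ) * μ p := by
    have h1 : ∀ n m, Integrable fun p => (inner ℂ (b n) (ρs (b m)) : ℂ) *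
        ((inner ℂ (b m) ((G p).adjoint a') * f p * inner ℂ a (G p (b n)) : ℂ) * μ p) := fun n m =>
      (hint n m).const_mul _
    simp_rw [← integral_const_mul]
    rw [Finset.sum_congr rfl fun n _ => (integral_finsetSum _ fun m _ => h1 n m).symm,
      ← integral_finsetSum _ fun n _ => integrable_finsetSum _ fun m _ => h1 n m]
    congr 1 with p
    simp only [ContinuousLinearMap.comp_apply]
    rw [← sum_inner_mul_inner_apply b (G p), Finset.sum_mul, Finset.sum_mul]
    refine Finset.sum_congr rfl fun n _ => ?_
    have h2 := sum_inner_mul_inner_apply b ρs 1 (b n) ((G p).adjoint a')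
    simp only [one_apply_eq_self] at h2
    rw [← h2, Finset.mul_sum, Finset.sum_mul, Finset.sum_mul]
    exact Finset.sum_congr rfl fun m _ => by ring
  rw [adjoint_mkL_comp_engineState_comp_mkL b hħ hG, hval]
  simp_rw [ContinuousLinearMap.finsetSum_comp]
  refine HasTrace.sum _ fun n _ => HasTrace.sum _ fun m _ => ?_
  rw [ContinuousLinearMap.smul_comp, ContinuousLinearMap.comp_assoc, ContinuousLinearMap.comp_assoc]
  refine HasTrace.const_smul ?_ _
  refine hμ.hasTrace hħ hρw (hC n m) (A := momentumFun ħ (fun p => inner ℂ a (G p (b n))))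
    (B := momentumFun ħ (fun p => inner ℂ (b m) ((G p).adjoint a')) ∘L momentumFun ħ f) ?_
  rw [momentumFun_comp hħ (hB m) hf, momentumFun_comp hħ (hf.mul' (hB m)) (hA n)]

end Fiber

/-! ### The unitaries of the system -/

section System

variable {ι : Type v} [Fintype ι]
  {S : Type u} [NormedAddCommGroup S] [InnerProductSpace ℂ S]
  (ħ : ℝ) (b : OrthonormalBasis ι ℂ S) (E : ι → ℝ) (V : S →L[ℂ] S) (p₀ : ℝ)

theorem systemUnitary_apply (p : ℝ) (j : ι) :
    systemUnitary ħ b E V p₀ p (b j) =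
      ∑ n, (Complex.exp (-Complex.I / ħ * (p - p₀) * (E j - E n)) *
        (inner ℂ (b n) (V (b j)) : ℂ)) • b n := by
  classical
  simp [systemUnitary, sum_apply, b.inner_eq_ite]

theorem inner_systemUnitary (p : ℝ) (n j : ι) :
    inner ℂ (b n) (systemUnitary ħ b E V p₀ p (b j)) =
      Complex.exp (-Complex.I / ħ * (p - p₀) * (E j - E n)) * (inner ℂ (b n) (V (b j)) : ℂ) := by
  rw [systemUnitary_apply, b.orthonormal.inner_right_fintype]

theorem continuous_systemUnitary : Continuous (systemUnitary ħ b E V p₀) := by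
  unfold systemUnitary
  fun_prop

theorem systemUnitary_self : systemUnitary ħ b E V p₀ p₀ = V := by
  refine ContinuousLinearMap.coe_injective (b.toBasis.ext fun j => ?_)
  simp only [OrthonormalBasis.coe_toBasis, ContinuousLinearMap.coe_coe, systemUnitary_apply,
    sub_self, mul_zero, zero_mul, Complex.exp_zero, one_mul]
  exact b.sum_repr' _

theorem memLp_top_exp (a : ℝ) :
    MemLp (fun p : ℝ => Complex.exp (-Complex.I / ħ * (p - p₀) * a)) ∞ := by
  refine memLp_top_of_bound (Continuous.aestronglyMeasurable (by fun_prop)) 1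
    (.of_forall fun p => ?_)
  rw [show -Complex.I / ħ * (p - p₀) * a = ((-(1 / ħ) * (p - p₀) * a : ℝ) : ℂ) * Complex.I by
    push_cast; ring, Complex.norm_exp_ofReal_mul_I]

theorem engineUnitary_eq_fiberOp (hħ : 0 < ħ) :
    engineUnitary ħ b E V p₀ = fiberOp ħ b (systemUnitary ħ b E V p₀) := by
  unfold engineUnitary fiberOp
  refine Finset.sum_congr rfl fun n _ => Finset.sum_congr rfl fun j _ => ?_
  have h := memLp_top_exp ħ p₀ (E j - E n)
  push_cast at h
  rw [← TensorProduct.mapL_smul_right, ← momentumFun_const_mul hħ h]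
  simp_rw [inner_systemUnitary, mul_comm (inner ℂ (b n) (V (b j)))]

variable [CompleteSpace S]

/-- In the interaction picture `U_s(p) = D† V D` for the diagonal unitary `D` with entries
`exp (-(i/ħ) (p - p₀) E_j)`. -/
theorem systemUnitary_mem_unitary (hV : V ∈ unitary (S →L[ℂ] S)) (p : ℝ) :
    systemUnitary ħ b E V p₀ p ∈ unitary (S →L[ℂ] S) := by
  classical
  let e : ℝ → ι → ℂ := fun s j => Complex.exp (((-(s / ħ) * (p - p₀) * E j : ℝ) : ℂ) * Complex.I)
  let D : ℝ → S →L[ℂ] S := fun s => ∑ j, e s j • rankOne ℂ (b j) (b j)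
  have hD : ∀ s j, D s (b j) = e s j • b j := fun s j => by
    simp [D, sum_apply, b.inner_eq_ite]
  have hstar : star (D 1) = D (-1) := by
    simp only [D, star_sum, star_smul, ContinuousLinearMap.star_eq_adjoint, adjoint_rankOne]
    refine Finset.sum_congr rfl fun j _ => ?_
    congr 1
    simp only [e, RCLike.star_def, ← Complex.exp_conj, map_mul, Complex.conj_I, Complex.conj_ofReal]
    congr 1
    push_cast
    ring
  have hmul : ∀ s, D (-s) * D s = 1 := fun s => by
    refine ContinuousLinearMap.coe_injective (b.toBasis.ext fun j => ?_)
    simp only [OrthonormalBasis.coe_toBasis, ContinuousLinearMap.coe_coe,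
      ContinuousLinearMap.mul_def, ContinuousLinearMap.comp_apply, hD, map_smul, smul_smul, e,
      ← Complex.exp_add, one_apply_eq_self]
    rw [show (((-(s / ħ) * (p - p₀) * E j : ℝ) : ℂ) * Complex.I +
      ((-(-s / ħ) * (p - p₀) * E j : ℝ) : ℂ) * Complex.I) = 0 by push_cast; ring,
      Complex.exp_zero, one_smul]
  have hDu : D 1 ∈ unitary (S →L[ℂ] S) := by
    rw [Unitary.mem_iff, hstar]
    exact ⟨hmul 1, by simpa using hmul (-1)⟩
  have heq : systemUnitary ħ b E V p₀ p = D (-1) * V * D 1 := by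
    refine ContinuousLinearMap.coe_injective (b.toBasis.ext fun j => ?_)
    simp only [OrthonormalBasis.coe_toBasis, ContinuousLinearMap.coe_coe,
      ContinuousLinearMap.mul_def, ContinuousLinearMap.comp_apply, hD, map_smul]
    rw [systemUnitary_apply]
    conv_rhs => rw [← b.sum_repr' (V (b j))]
    rw [map_sum, Finset.smul_sum]
    refine Finset.sum_congr rfl fun n _ => ?_
    rw [map_smul, hD, smul_smul, smul_smul, mul_right_comm (e 1 j)]
    congr 2
    simp only [e, ← Complex.exp_add]
    congr 1
    push_cast
    ring
  rw [heq, ← hstar]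
  exact mul_mem (mul_mem (Unitary.star_mem hDu) hV) hDu

theorem norm_le_one_of_mem_unitary {U : S →L[ℂ] S} (hU : U ∈ unitary (S →L[ℂ] S)) : ‖U‖ ≤ 1 := by
  refine U.opNorm_le_bound zero_le_one fun x => ?_
  rw [one_mul, U.norm_map_of_mem_unitary hU]

theorem memLp_top_systemUnitary (hV : V ∈ unitary (S →L[ℂ] S)) :
    MemLp (systemUnitary ħ b E V p₀) ∞ :=
  memLp_top_of_bound (continuous_systemUnitary ħ b E V p₀).aestronglyMeasurable 1
    (.of_forall fun p => norm_le_one_of_mem_unitary (systemUnitary_mem_unitary ħ b E V p₀ hV p))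

end System

/-! ### Commutation of the engine with its Hamiltonian and with the momentum -/

section Engine

theorem Commutes.smul {H : Type u} [NormedAddCommGroup H] [InnerProductSpace ℂ H]
    {U : H →L[ℂ] H} {A : H →ₗ.[ℂ] H} (h : Commutes U A) (c : ℂ) : Commutes (c • U) A := fun x => by
  obtain ⟨hx, hA⟩ := h x
  refine ⟨A.domain.smul_mem c hx, (A.map_smul c ⟨_, hx⟩).trans ?_⟩
  rw [hA, smul_apply]

theorem Commutes.sum {H : Type u} [NormedAddCommGroup H] [InnerProductSpace ℂ H] {α : Type*}
    (s : Finset α) {U : α → H →L[ℂ] H} {A : H →ₗ.[ℂ] H} (h : ∀ i ∈ s, Commutes (U i) A) :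
    Commutes (∑ i ∈ s, U i) A := by
  induction s using Finset.cons_induction with
  | empty => exact fun x => ⟨A.domain.zero_mem, A.map_zero⟩
  | cons a s ha ih =>
    intro x
    obtain ⟨h1, h1'⟩ := h a (Finset.mem_cons_self a s) x
    obtain ⟨h2, h2'⟩ := ih (fun i hi => h i (Finset.mem_cons_of_mem hi)) x
    rw [Finset.sum_cons]
    refine ⟨A.domain.add_mem h1 h2, (A.map_add ⟨_, h1⟩ ⟨_, h2⟩).trans ?_⟩
    rw [h1', h2', add_apply]

variable {S : Type u} [NormedAddCommGroup S] [InnerProductSpace ℂ S]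
  {W : Type v} [NormedAddCommGroup W] [InnerProductSpace ℂ W]

theorem oneTensor_apply (A : W →ₗ.[ℂ] W) (y : S ⊗[ℂ] A.domain)
    (h : A.domain.subtype.lTensor S y ∈ (oneTensor S A).domain) :
    oneTensor S A ⟨A.domain.subtype.lTensor S y, h⟩ = A.toFun.lTensor S y := by
  have h' : (⟨A.domain.subtype.lTensor S y, h⟩ : (oneTensor S A).domain) =
      LinearEquiv.ofInjective (A.domain.subtype.lTensor S)
        (Module.Flat.lTensor_preserves_injective_linearMap _ A.domain.injective_subtype) y := rfl
  rw [h']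
  change (A.toFun.lTensor S) ((LinearEquiv.ofInjective (A.domain.subtype.lTensor S)
    (Module.Flat.lTensor_preserves_injective_linearMap _ A.domain.injective_subtype)).symm _) = _
  rw [LinearEquiv.symm_apply_apply]

/-- `r ⊗ m` conserves `B ⊗ 1 + 1 ⊗ A` as soon as `m` raises `A` by the amount `a` by which `r`
lowers `B`. -/
theorem commutes_mapL (A : W →ₗ.[ℂ] W) (B r : S →L[ℂ] S) (m : W →L[ℂ] W) (a : ℂ)
    (hm : ∀ ψ : A.domain, ∃ h : m ψ ∈ A.domain, A ⟨m ψ, h⟩ = m (A ψ) + a • m ψ)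
    (hr : ∀ s, B (r s) + a • r s = r (B s)) :
    Commutes (TensorProduct.mapL r m)
      ((B.rTensor W : (S ⊗[ℂ] W) →ₗ[ℂ] (S ⊗[ℂ] W)) +ᵥ oneTensor S A) := by
  -- `m` restricted to the domain of `A`, so that `r ⊗ m` acts on `S ⊗ dom A`
  let m' : A.domain →ₗ[ℂ] A.domain :=
    ((m : W →ₗ[ℂ] W) ∘ₗ A.domain.subtype).codRestrict A.domain fun ψ => (hm ψ).1
  rintro ⟨_, y, rfl⟩
  have hU : TensorProduct.mapL r m (A.domain.subtype.lTensor S y) =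
      A.domain.subtype.lTensor S (TensorProduct.map (r : S →ₗ[ℂ] S) m' y) := by
    induction y using TensorProduct.induction_on with
    | zero => simp only [map_zero]
    | add x y hx hy => simp only [map_add, hx, hy]
    | tmul s ψ => rfl
  have hmem : TensorProduct.mapL r m (A.domain.subtype.lTensor S y) ∈ (oneTensor S A).domain :=
    hU ▸ ⟨_, rfl⟩
  refine ⟨hmem, ?_⟩
  rw [LinearPMap.vadd_apply, LinearPMap.vadd_apply]
  have h1 : oneTensor S A ⟨TensorProduct.mapL r m (A.domain.subtype.lTensor S y), hmem⟩ =
      A.toFun.lTensor S (TensorProduct.map (r : S →ₗ[ℂ] S) m' y) := by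
    rw [← oneTensor_apply A _ ⟨_, rfl⟩]
    congr 1
    exact Subtype.ext hU
  have h2 : oneTensor S A ⟨A.domain.subtype.lTensor S y, ⟨y, rfl⟩⟩ = A.toFun.lTensor S y :=
    oneTensor_apply A y _
  refine (congrArg₂ (· + ·) rfl h1).trans (Eq.trans ?_ (congrArg _ (congrArg₂ (· + ·) rfl h2.symm)))
  change B.rTensor W (TensorProduct.mapL r m (A.domain.subtype.lTensor S y)) +
    A.toFun.lTensor S (TensorProduct.map (r : S →ₗ[ℂ] S) m' y) =
    TensorProduct.mapL r m (B.rTensor W (A.domain.subtype.lTensor S y) + A.toFun.lTensor S y)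
  clear h1 h2 hmem
  rw [hU]
  clear hU
  induction y using TensorProduct.induction_on with
  | zero => simp only [map_zero, add_zero]
  | add x y hx hy =>
    simp only [map_add] at hx hy ⊢
    rw [add_add_add_comm, hx, hy, add_add_add_comm]
  | tmul s ψ =>
    have hA : A.toFun (m' ψ) = m (A ψ) + a • m ψ := (hm ψ).2
    simp only [TensorProduct.map_tmul, LinearMap.lTensor_tmul, hA, map_add]
    change B (r s) ⊗ₜ[ℂ] m ψ + r s ⊗ₜ[ℂ] (m (A ψ) + a • m ψ) =
      r (B s) ⊗ₜ[ℂ] m ψ + r s ⊗ₜ[ℂ] m (A ψ)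
    rw [← hr, add_tmul, tmul_add, tmul_smul, smul_tmul']
    abel

variable {ι : Type v} [Fintype ι] {ħ : ℝ}
  (b : OrthonormalBasis ι ℂ S) (E : ι → ℝ) (V : S →L[ℂ] S) (p₀ : ℝ)

theorem commutes_engineUnitary_momentumOp (hħ : 0 < ħ) :
    Commutes (engineUnitary ħ b E V p₀) (oneTensor S (momentumOp ħ)) := by
  refine Commutes.sum _ fun n _ => Commutes.sum _ fun j _ => Commutes.smul ?_ _
  have hexp := memLp_top_exp ħ p₀ (E j - E n)
  push_cast at hexp
  have h := commutes_mapL (momentumOp ħ) (0 : S →L[ℂ] S) (rankOne ℂ (b n) (b j))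
    (momentumFun ħ fun p => Complex.exp (-Complex.I / ħ * (p - p₀) * (E j - E n))) 0
    (fun ψ => by
      obtain ⟨h1, h2⟩ := commutes_momentumFun_momentumOp hħ hexp ψ
      exact ⟨h1, by rw [h2, zero_smul, add_zero]⟩)
    (fun s => by simp)
  rw [ContinuousLinearMap.rTensor_zero, ContinuousLinearMap.toLinearMap_zero, zero_vadd] at h
  exact h

/-- Each term of `U_e` conserves energy by itself: `|E_n⟩⟨E_j|` lowers the energy of the system by
`E_j - E_n`, and the translation by `E_j - E_n` raises the position of the weight by as much. -/
theorem commutes_engineUnitary_engineHamiltonian (hħ : 0 < ħ) [CompleteSpace S]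
    {Hs : S →L[ℂ] S}
    (hHs : IsSelfAdjoint Hs) (hE : ∀ j, Hs (b j) = (E j : ℂ) • b j) :
    Commutes (engineUnitary ħ b E V p₀) (engineHamiltonian Hs) := by
  refine Commutes.sum _ fun n _ => Commutes.sum _ fun j _ => Commutes.smul ?_ _
  refine commutes_mapL positionOp Hs _ _ (E j - E n) (fun ψ => ?_) fun s => ?_
  · have h := positionOp_momentumFun_exp hħ p₀ (E j - E n) ψ
    push_cast at h
    exact h
  · have hs : inner ℂ (b j) (Hs s) = (E j : ℂ) * inner ℂ (b j) s := by
      rw [← ContinuousLinearMap.adjoint_inner_left, ← ContinuousLinearMap.star_eq_adjoint,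
        hHs.star_eq, hE, inner_smul_left, Complex.conj_ofReal]
    rw [rankOne_apply, rankOne_apply, map_smul, hE, hs]
    module

end Engine

/-! ### The final states of the system and of the weight -/

section FinalState

variable {ι : Type v} [Fintype ι]
  {S : Type u} [NormedAddCommGroup S] [InnerProductSpace ℂ S] [CompleteSpace S] {ħ : ℝ}

theorem integrable_ofReal_smul {F : Type*} [NormedAddCommGroup F] [NormedSpace ℂ F] {μ : ℝ → ℝ}
    {G : ℝ → F} (hμ : Integrable μ) (hG : MemLp G ∞) : Integrable fun p => (μ p : ℂ) • G p :=
  hμ.ofReal.smul_of_top_left hG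

theorem memLp_top_conj_adjoint {G : ℝ → S →L[ℂ] S} (hG : MemLp G ∞) (ρs : S →L[ℂ] S) :
    MemLp (fun p => G p ∘L ρs ∘L (G p).adjoint) ∞ :=
  memLp_top_comp hG (memLp_top_comp (memLp_top_const ρs) (memLp_top_adjoint hG))

variable [FiniteDimensional ℂ S] (b : OrthonormalBasis ι ℂ S)

theorem hasPartialTrace_engineState (hħ : 0 < ħ) {G : ℝ → S →L[ℂ] S} (hG : MemLp G ∞)
    (ρs : S →L[ℂ] S) {ρw : Weight →L[ℂ] Weight} {μ : ℝ → ℝ} (hρw : IsDensityOperator ρw)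
    (hμ : IsMomentumDensity ħ ρw μ) :
    HasPartialTrace (engineState (fiberOp ħ b G) ρs ρw)
      (∫ p : ℝ, (μ p : ℂ) • (G p ∘L ρs ∘L (G p).adjoint)) := by
  intro a a'
  have h := hasTrace_engineState b hħ hG ρs hρw hμ (memLp_top_const 1) a a'
  rw [momentumFun_const hħ, one_smul] at h
  convert! h using 1
  have hi := integrable_ofReal_smul hμ.2.1 (memLp_top_conj_adjoint hG ρs)
  rw [← ContinuousLinearMap.apply_apply (𝕜 := ℂ) a', ← innerSL_apply_apply ℂ,
    ← ContinuousLinearMap.comp_apply, ← ContinuousLinearMap.integral_comp_comm _ hi]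
  congr 1 with p
  simp only [ContinuousLinearMap.comp_apply, map_smul, smul_eq_mul, innerSL_apply_apply,
    ContinuousLinearMap.apply_apply, mul_one]
  ring

theorem isPositive_mapL {ρs : S →L[ℂ] S} {ρw : Weight →L[ℂ] Weight} (hs : ρs.IsPositive)
    (hw : ρw.IsPositive) : (TensorProduct.mapL ρs ρw).IsPositive := by
  obtain ⟨Rs, hRs, rfl⟩ := exists_adjoint_eq_comp_self_eq hs
  obtain ⟨Rw, hRw, rfl⟩ := exists_adjoint_eq_comp_self_eq hw
  have h := ContinuousLinearMap.isPositive_adjoint_comp_self (TensorProduct.mapL Rs Rw)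
  rwa [TensorProduct.adjoint_mapL, hRs, hRw, ← TensorProduct.mapL_comp] at h

/-- `Tr (G ρ G†) = 1`, in terms of an orthonormal basis. -/
theorem trace_unitary_conj {G ρ : S →L[ℂ] S} (hG : G ∈ unitary (S →L[ℂ] S))
    (hρ : IsDensityOperator ρ) :
    ∑ i, (inner ℂ (b i) ((G ∘L ρ ∘L G.adjoint) (b i)) : ℂ) = 1 := by
  have h : (G ∘L ρ ∘L G.adjoint : S →L[ℂ] S).toLinearMap.trace ℂ S = ρ.toLinearMap.trace ℂ S := by
    have h1 : G.adjoint.toLinearMap ∘ₗ G.toLinearMap = LinearMap.id :=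
      congrArg ContinuousLinearMap.toLinearMap (Unitary.star_mul_self_of_mem hG)
    rw [ContinuousLinearMap.toLinearMap_comp, ContinuousLinearMap.toLinearMap_comp,
      LinearMap.trace_comp_comm', LinearMap.comp_assoc, h1, LinearMap.comp_id]
  rw [← hρ.2.eq_trace, LinearMap.trace_eq_sum_inner _ b] at h
  exact h

/-- The statistics of the momentum are those of the initial state of the weight, since the system
factors `G p ρ_s (G p)†` all have trace one. -/
theorem hasTrace_partialTraceLeft (hħ : 0 < ħ) {G : ℝ → S →L[ℂ] S} (hG : MemLp G ∞)
    (hu : ∀ p, G p ∈ unitary (S →L[ℂ] S))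
    {ρs : S →L[ℂ] S} (hρs : IsDensityOperator ρs) {ρw : Weight →L[ℂ] Weight} {μ : ℝ → ℝ}
    (hρw : IsDensityOperator ρw) (hμ : IsMomentumDensity ħ ρw μ) {f : ℝ → ℂ} (hf : MemLp f ∞) :
    HasTrace (partialTraceLeft (engineState (fiberOp ħ b G) ρs ρw) ∘L momentumFun ħ f)
      (∫ p, f p * μ p) := by
  have hi : ∀ i, Integrable fun p => (inner ℂ (stdOrthonormalBasis ℂ S i)
      ((G p ∘L ρs ∘L (G p).adjoint) (stdOrthonormalBasis ℂ S i)) * f p * μ p : ℂ) := fun i =>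
    memLp_one_iff_integrable.mp ((memLp_one_iff_integrable.mpr hμ.2.1.ofReal).mul'
      (hf.mul' (memLp_top_inner_apply (memLp_top_conj_adjoint hG ρs) _ _) (r := ∞)))
  have h : ∫ p, f p * μ p = ∑ i, ∫ p, (inner ℂ (stdOrthonormalBasis ℂ S i)
      ((G p ∘L ρs ∘L (G p).adjoint) (stdOrthonormalBasis ℂ S i)) * f p * μ p : ℂ) := by
    rw [← integral_finsetSum _ fun i _ => hi i]
    congr 1 with p
    rw [← Finset.sum_mul, ← Finset.sum_mul, trace_unitary_conj _ (hu p) hρs, one_mul]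
  rw [h, partialTraceLeft, ContinuousLinearMap.finsetSum_comp]
  exact HasTrace.sum _ fun i _ => hasTrace_engineState b hħ hG ρs hρw hμ hf _ _

theorem isDensityOperator_partialTraceLeft (hħ : 0 < ħ) {G : ℝ → S →L[ℂ] S} (hG : MemLp G ∞)
    (hu : ∀ p, G p ∈ unitary (S →L[ℂ] S))
    {ρs : S →L[ℂ] S} (hρs : IsDensityOperator ρs) {ρw : Weight →L[ℂ] Weight}
    (hρw : IsDensityOperator ρw) :
    IsDensityOperator (partialTraceLeft (engineState (fiberOp ħ b G) ρs ρw)) := by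
  constructor
  · rw [partialTraceLeft]
    exact ContinuousLinearMap.isPositive_sum _ fun i _ =>
      ((isPositive_mapL hρs.1 hρw.1).conj_adjoint _).adjoint_conj _
  · obtain ⟨μ, hμ⟩ := hρw.exists_isMomentumDensity hħ
    have h := hasTrace_partialTraceLeft b hħ hG hu hρs hρw hμ (memLp_top_const 1)
    simp_rw [one_mul, integral_complex_ofReal, hμ.integral_eq_one hħ hρw, momentumFun_const hħ,
      one_smul] at h
    exact_mod_cast h

/-- The traces which define the momentum distributions of both states exist and agree. -/
theorem isMomentumDensity_partialTraceLeft_iff (hħ : 0 < ħ) {G : ℝ → S →L[ℂ] S} (hG : MemLp G ∞)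
    (hu : ∀ p, G p ∈ unitary (S →L[ℂ] S))
    {ρs : S →L[ℂ] S} (hρs : IsDensityOperator ρs) {ρw : Weight →L[ℂ] Weight}
    (hρw : IsDensityOperator ρw) (μ : ℝ → ℝ) :
    IsMomentumDensity ħ (partialTraceLeft (engineState (fiberOp ħ b G) ρs ρw)) μ ↔
      IsMomentumDensity ħ ρw μ := by
  obtain ⟨μ₀, hμ₀⟩ := hρw.exists_isMomentumDensity hħ
  have h : ∀ A, MeasurableSet A →
      HasTrace (partialTraceLeft (engineState (fiberOp ħ b G) ρs ρw) ∘L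
        momentumFun ħ (A.indicator 1)) ((∫ p in A, μ₀ p : ℝ) : ℂ) := fun A hA => by
    rw [← integral_indicator_one_mul hA]
    exact hasTrace_partialTraceLeft b hħ hG hu hρs hρw hμ₀ (memLp_top_indicator_one hA)
  constructor
  · exact fun hμ => ⟨hμ.1, hμ.2.1, fun A hA =>
      (hμ.2.2 A hA).unique (h A hA) ▸ hμ₀.2.2 A hA⟩
  · exact fun hμ => ⟨hμ.1, hμ.2.1, fun A hA =>
      (hμ.2.2 A hA).unique (hμ₀.2.2 A hA) ▸ h A hA⟩

end FinalState

/-! ### Concentrated momentum distributions -/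

section Concentration

theorem integral_rescale (h : ℝ → ℝ) (p₀ : ℝ) {δ : ℝ} (hδ : 0 < δ) :
    ∫ p, rescale h p₀ δ p = ∫ p, h p := by
  unfold rescale
  rw [integral_const_mul, integral_sub_right_eq_self (fun p => h (p / δ + p₀)) p₀,
    Measure.integral_comp_div (fun p => h (p + p₀)), integral_add_right_eq_self, abs_of_pos hδ,
    smul_eq_mul]
  field_simp

theorem integrable_rescale {h : ℝ → ℝ} (hh : Integrable h) (p₀ : ℝ) {δ : ℝ} (hδ : 0 < δ) :
    Integrable (rescale h p₀ δ) :=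
  (((hh.comp_add_right p₀).comp_div hδ.ne').comp_sub_right p₀).const_mul _

theorem setIntegral_rescale (μ : ℝ → ℝ) (p₀ η : ℝ) {δ : ℝ} (hδ : 0 < δ) :
    ∫ p in {p : ℝ | η ≤ |p - p₀|}, rescale μ p₀ δ p = ∫ p in {p : ℝ | η / δ ≤ |p - p₀|}, μ p := by
  have hm : ∀ r : ℝ, MeasurableSet {p : ℝ | r ≤ |p - p₀|} := fun r =>
    measurableSet_le measurable_const (by fun_prop)
  rw [← integral_indicator (hm η), ← integral_indicator (hm (η / δ)),
    ← integral_rescale (Set.indicator _ μ) p₀ hδ]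
  congr 1 with p
  have hiff : η ≤ |p - p₀| ↔ η / δ ≤ |(p - p₀) / δ + p₀ - p₀| := by
    rw [add_sub_cancel_right, abs_div, abs_of_pos hδ, div_le_div_iff_of_pos_right hδ]
  by_cases hp : η ≤ |p - p₀|
  · simp only [rescale, Set.indicator, Set.mem_ofPred_eq, if_pos hp, if_pos (hiff.mp hp)]
  · simp only [rescale, Set.indicator, Set.mem_ofPred_eq, if_neg hp, if_neg (mt hiff.mpr hp),
      mul_zero]

/-- By `setIntegral_rescale`, this is the smallness of the tails of `μ`. -/
theorem exists_forall_setIntegral_rescale_le {μ : ℝ → ℝ} (h0 : ∀ p, 0 ≤ μ p) (hi : Integrable μ)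
    (p₀ : ℝ) {η : ℝ} (hη : 0 < η) :
    ∃ δ₀ : ℝ, 0 < δ₀ ∧ ∀ δ : ℝ, 0 < δ → δ ≤ δ₀ →
      ∫ p in {p : ℝ | η ≤ |p - p₀|}, rescale μ p₀ δ p ≤ η := by
  have hm : ∀ r : ℝ, MeasurableSet {p : ℝ | r ≤ |p - p₀|} := fun r =>
    measurableSet_le measurable_const (by fun_prop)
  have ht := tendsto_setIntegral_of_antitone (μ := (volume : Measure ℝ)) (f := μ)
    (s := fun n : ℕ => {p : ℝ | (n : ℝ) ≤ |p - p₀|}) (fun n => hm n)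
    (fun n m hnm p (hp : (m : ℝ) ≤ _) => le_trans (Nat.cast_le.mpr hnm) hp) ⟨0, hi.integrableOn⟩
  have hempty : ⋂ n : ℕ, {p : ℝ | (n : ℝ) ≤ |p - p₀|} = ∅ := by
    refine Set.eq_empty_of_forall_notMem fun p hp => ?_
    obtain ⟨n, hn⟩ := exists_nat_gt |p - p₀|
    exact absurd (Set.mem_iInter.mp hp n) (not_le.mpr hn)
  rw [hempty, setIntegral_empty] at ht
  obtain ⟨n, hn⟩ := (ht.eventually (ge_mem_nhds hη)).exists
  refine ⟨η / (n + 1), by positivity, fun δ hδ hle => ?_⟩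
  rw [setIntegral_rescale μ p₀ η hδ]
  refine le_trans (setIntegral_mono_set hi.integrableOn (.of_forall h0) ?_) hn
  refine LE.le.eventuallyLE fun p (hp : η / δ ≤ _) => ?_
  have : (n : ℝ) ≤ η / δ := by
    rw [le_div_iff₀ hδ]
    rw [le_div_iff₀ (by positivity)] at hle
    nlinarith
  exact this.trans hp

variable {S : Type u} [NormedAddCommGroup S] [InnerProductSpace ℂ S]  [CompleteSpace S]

theorem norm_conj_adjoint_le {G ρ : S →L[ℂ] S} (hG : ‖G‖ ≤ 1) (hρ : ‖ρ‖ ≤ 1) :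
    ‖G ∘L ρ ∘L G.adjoint‖ ≤ 1 := by
  have hG' : ‖G.adjoint‖ ≤ 1 := by rwa [LinearIsometryEquiv.norm_map]
  calc ‖G ∘L ρ ∘L G.adjoint‖ ≤ ‖G‖ * (‖ρ‖ * ‖G.adjoint‖) :=
        (G.opNorm_comp_le _).trans (by gcongr; exact ρ.opNorm_comp_le _)
    _ ≤ 1 * (1 * 1) := by gcongr
    _ = 1 := by norm_num

theorem norm_conj_adjoint_sub_le {G V ρ : S →L[ℂ] S} (hG : ‖G‖ ≤ 1) (hV : ‖V‖ ≤ 1)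
    (hρ : ‖ρ‖ ≤ 1) : ‖G ∘L ρ ∘L G.adjoint - V ∘L ρ ∘L V.adjoint‖ ≤ 2 * ‖G - V‖ := by
  have hG' : ‖G.adjoint‖ ≤ 1 := by rwa [LinearIsometryEquiv.norm_map]
  have heq : G ∘L ρ ∘L G.adjoint - V ∘L ρ ∘L V.adjoint =
      (G - V) ∘L ρ ∘L G.adjoint + V ∘L ρ ∘L (G - V).adjoint := by
    rw [map_sub, ContinuousLinearMap.sub_comp, ContinuousLinearMap.comp_sub,
      ContinuousLinearMap.comp_sub]
    abel
  rw [heq]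
  calc _ ≤ ‖(G - V) ∘L ρ ∘L G.adjoint‖ + ‖V ∘L ρ ∘L (G - V).adjoint‖ := norm_add_le _ _
    _ ≤ ‖G - V‖ * (‖ρ‖ * ‖G.adjoint‖) + ‖V‖ * (‖ρ‖ * ‖(G - V).adjoint‖) := by
        refine add_le_add ((ContinuousLinearMap.opNorm_comp_le _ _).trans ?_)
          ((ContinuousLinearMap.opNorm_comp_le _ _).trans ?_) <;>
        gcongr <;> exact ρ.opNorm_comp_le _
    _ ≤ ‖G - V‖ * (1 * 1) + 1 * (1 * ‖G - V‖) := by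
        rw [LinearIsometryEquiv.norm_map ContinuousLinearMap.adjoint (G - V)]
        gcongr
    _ = 2 * ‖G - V‖ := by ring

variable [FiniteDimensional ℂ S]

/-- A mixture of the conjugates `G p ρ (G p)†` is close to `V ρ V†`, uniformly in `ρ`, when `G p₀ = V`
and the mixing density is concentrated near `p₀`: near `p₀` continuity bounds the error, and far
from `p₀` it is at most `2` with small probability. -/
theorem exists_forall_traceNorm_integral_sub_le {G : ℝ → S →L[ℂ] S} (hG : Continuous G)
    (hG1 : ∀ p, ‖G p‖ ≤ 1) (p₀ : ℝ) {ε : ℝ} (hε : 0 < ε) :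
    ∃ η : ℝ, 0 < η ∧ ∀ μ : ℝ → ℝ, (∀ p, 0 ≤ μ p) → Integrable μ → ∫ p, μ p = 1 →
      ∫ p in {p : ℝ | η ≤ |p - p₀|}, μ p ≤ η → ∀ ρ : S →L[ℂ] S, ‖ρ‖ ≤ 1 →
        traceNorm ((∫ p : ℝ, (μ p : ℂ) • (G p ∘L ρ ∘L (G p).adjoint)) -
          G p₀ ∘L ρ ∘L (G p₀).adjoint) ≤ ε := by
  set d : ℝ := (Module.finrank ℂ S : ℝ) with hd
  have hd0 : 0 ≤ d := Nat.cast_nonneg _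
  -- the operator norm of the error is at most `4κ`, and the trace norm at most `d` times that
  set κ : ℝ := ε / (4 * (d + 1)) with hκ
  have hκ0 : 0 < κ := by positivity
  obtain ⟨η, hη, hηG⟩ := Metric.continuous_iff.mp hG p₀ κ hκ0
  refine ⟨min η κ, lt_min hη hκ0, fun μ h0 hi h1 hfar ρ hρ => ?_⟩
  set A := {p : ℝ | min η κ ≤ |p - p₀|} with hA
  have hmA : MeasurableSet A := measurableSet_le measurable_const (by fun_prop)
  have hGm : MemLp G ∞ := memLp_top_of_bound hG.aestronglyMeasurable 1 (.of_forall hG1)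
  have hint1 := integrable_ofReal_smul hi (memLp_top_conj_adjoint hGm ρ)
  have hint2 := integrable_ofReal_smul hi (memLp_top_const (G p₀ ∘L ρ ∘L (G p₀).adjoint))
  have hdiff : (∫ p : ℝ, (μ p : ℂ) • (G p ∘L ρ ∘L (G p).adjoint)) - G p₀ ∘L ρ ∘L (G p₀).adjoint =
      ∫ p : ℝ, (μ p : ℂ) • (G p ∘L ρ ∘L (G p).adjoint - G p₀ ∘L ρ ∘L (G p₀).adjoint) := by
    simp_rw [smul_sub]
    rw [integral_sub hint1 hint2, integral_smul_const, integral_complex_ofReal, h1,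
      Complex.ofReal_one, one_smul]
  have hbound : ∀ p, ‖(μ p : ℂ) • (G p ∘L ρ ∘L (G p).adjoint - G p₀ ∘L ρ ∘L (G p₀).adjoint)‖ ≤
      2 * κ * μ p + 2 * A.indicator μ p := fun p => by
    rw [norm_smul, Complex.norm_real, Real.norm_of_nonneg (h0 p)]
    by_cases hp : p ∈ A
    · have h2 : ‖G p ∘L ρ ∘L (G p).adjoint - G p₀ ∘L ρ ∘L (G p₀).adjoint‖ ≤ 2 :=
        (norm_sub_le _ _).trans (by
          linarith [norm_conj_adjoint_le (hG1 p) hρ, norm_conj_adjoint_le (hG1 p₀) hρ])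
      rw [Set.indicator_of_mem hp]
      nlinarith [h0 p, mul_le_mul_of_nonneg_left h2 (h0 p), mul_nonneg hκ0.le (h0 p)]
    · have hlt : |p - p₀| < η := lt_of_lt_of_le (not_le.mp hp) (min_le_left _ _)
      have h2 : ‖G p ∘L ρ ∘L (G p).adjoint - G p₀ ∘L ρ ∘L (G p₀).adjoint‖ ≤ 2 * κ :=
        (norm_conj_adjoint_sub_le (hG1 p) (hG1 p₀) hρ).trans (by
          have := hηG p hlt
          rw [dist_eq_norm] at this
          linarith)
      rw [Set.indicator_of_notMem hp]
      nlinarith [mul_le_mul_of_nonneg_left h2 (h0 p)]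
  have hnorm : ‖∫ p : ℝ, (μ p : ℂ) • (G p ∘L ρ ∘L (G p).adjoint - G p₀ ∘L ρ ∘L (G p₀).adjoint)‖ ≤
      4 * κ := by
    refine (norm_integral_le_of_norm_le ((hi.const_mul _).add
      ((hi.indicator hmA).const_mul 2)) (.of_forall hbound)).trans ?_
    have h3 := integral_add (hi.const_mul (2 * κ)) ((hi.indicator hmA).const_mul 2)
    rw [integral_const_mul, integral_const_mul, h1, integral_indicator hmA] at h3
    refine h3.le.trans ?_
    linarith [hfar.trans (min_le_right η κ)]
  rw [hdiff]
  calc _ ≤ d * _ := traceNorm_le _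
    _ ≤ d * (4 * κ) := by gcongr
    _ ≤ (d + 1) * (4 * κ) := by gcongr; linarith
    _ = ε := by rw [hκ]; field_simp

end Concentration

/-! ### Permutations of the energy levels -/

section Permutation

variable {ι : Type v} [Fintype ι]
  {S : Type u} [NormedAddCommGroup S] [InnerProductSpace ℂ S] [CompleteSpace S]
  (ħ : ℝ) (b : OrthonormalBasis ι ℂ S) (E : ι → ℝ) (V : S →L[ℂ] S) (p₀ : ℝ)

/-- If `V` permutes the energy levels, then `U_s(p)` differs from `V` only by phases, which cancel
in the conjugate of a diagonal state. -/
theorem systemUnitary_conj_diagonal (π : Equiv.Perm ι) (hπ : ∀ j, V (b j) = b (π j)) (q : ι → ℂ)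
    (p : ℝ) :
    systemUnitary ħ b E V p₀ p ∘L (∑ n, q n • rankOne ℂ (b n) (b n)) ∘L
        (systemUnitary ħ b E V p₀ p).adjoint =
      V ∘L (∑ n, q n • rankOne ℂ (b n) (b n)) ∘L V.adjoint := by
  classical
  have hconj : ∀ (G : S →L[ℂ] S), G ∘L (∑ n, q n • rankOne ℂ (b n) (b n)) ∘L G.adjoint =
      ∑ n, q n • rankOne ℂ (G (b n)) (G (b n)) := fun G => by
    simp_rw [ContinuousLinearMap.finsetSum_comp, ContinuousLinearMap.comp_finsetSum,
      ContinuousLinearMap.smul_comp, ContinuousLinearMap.comp_smul, rankOne_comp, comp_rankOne,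
      ContinuousLinearMap.adjoint_adjoint]
  rw [hconj, hconj]
  refine Finset.sum_congr rfl fun n _ => ?_
  have h : systemUnitary ħ b E V p₀ p (b n) =
      Complex.exp (((-(1 / ħ) * (p - p₀) * (E n - E (π n)) : ℝ) : ℂ) * Complex.I) • V (b n) := by
    rw [systemUnitary_apply, Finset.sum_eq_single (π n)]
    · rw [hπ, b.inner_eq_one, mul_one]
      congr 2
      push_cast
      ring
    · intro m _ hm
      rw [hπ, b.inner_eq_zero hm, mul_zero, zero_smul]
    · exact fun h => absurd (Finset.mem_univ _) h
  rw [h]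
  congr 1
  ext x
  rw [rankOne_apply, rankOne_apply, inner_smul_left, smul_smul, mul_right_comm, RCLike.conj_mul,
    Complex.norm_exp_ofReal_mul_I]
  simp

end Permutation

end QuantumWeight

theorem mainTheorem2 {S : Type*} [NormedAddCommGroup S] [InnerProductSpace ℂ S]
    [FiniteDimensional ℂ S] [CompleteSpace S] {ι : Type*} [Fintype ι]
    (ħ : ℝ) (hħ : 0 < ħ)
    -- the Hamiltonian of the system, with its energy levels and an orthonormal energy eigenbasis
    (Hs : S →L[ℂ] S) (hHs : IsSelfAdjoint Hs)
    (b : OrthonormalBasis ι ℂ S) (E : ι → ℝ) (hE : ∀ j, Hs (b j) = (E j : ℂ) • b j)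
    -- the target unitary and the reference momentum
    (V : S →L[ℂ] S) (hV : V ∈ unitary (S →L[ℂ] S)) (p₀ : ℝ)
    -- the unitary of the engine and the associated family of unitaries of the system
    (U : (S ⊗[ℂ] Weight) →L[ℂ] (S ⊗[ℂ] Weight)) (hU : U = engineUnitary ħ b E V p₀)
    (Us : ℝ → S →L[ℂ] S) (hUs : ∀ p, Us p = systemUnitary ħ b E V p₀ p) :
    -- `U` is unitary, energy-conserving and translation-invariant
    (U ∈ unitary ((S ⊗[ℂ] Weight) →L[ℂ] (S ⊗[ℂ] Weight)) ∧
      Commutes U (engineHamiltonian Hs) ∧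
      Commutes U (oneTensor S (momentumOp ħ))) ∧
    -- `U = ∫ Us p ⊗ |p⟩⟨p| dp` in the weak sense, with `Us p` unitary and `Us p₀ = V`
    ((∀ p, Us p ∈ unitary (S →L[ℂ] S)) ∧ Us p₀ = V ∧
      ∀ (a a' : S) (φ ψ : Weight),
        Integrable (fun p : ℝ => inner ℂ a (Us p a') *
          (conj (momentumWave ħ φ p) * momentumWave ħ ψ p)) ∧
        inner ℂ (a ⊗ₜ[ℂ] φ) (U (a' ⊗ₜ[ℂ] ψ)) =
          ∫ p : ℝ, inner ℂ a (Us p a') *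
            (conj (momentumWave ħ φ p) * momentumWave ħ ψ p)) ∧
    -- every weight state has a momentum distribution, of total mass one
    (∀ ρw : Weight →L[ℂ] Weight, IsDensityOperator ρw →
      (∃ μ, IsMomentumDensity ħ ρw μ) ∧ ∀ μ, IsMomentumDensity ħ ρw μ → ∫ p, μ p = 1) ∧
    -- the reduced final state of the system is a mixture of unitary conjugates
    (∀ (ρs : S →L[ℂ] S) (ρw : Weight →L[ℂ] Weight) (μ : ℝ → ℝ),
      IsDensityOperator ρs → IsDensityOperator ρw → IsMomentumDensity ħ ρw μ →
      Integrable (fun p : ℝ => (μ p : ℂ) • (Us p ∘L ρs ∘L (Us p).adjoint)) ∧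
      HasPartialTrace (engineState U ρs ρw)
        (∫ p : ℝ, (μ p : ℂ) • (Us p ∘L ρs ∘L (Us p).adjoint))) ∧
    -- approximation of `V ρs V†`, when a momentum density is rescaled around `p₀`;
    -- weight states with the rescaled density exist
    (∀ μ : ℝ → ℝ, (∀ p, 0 ≤ μ p) → Integrable μ → ∫ p, μ p = 1 →
      ∀ ε : ℝ, 0 < ε → ∃ δ₀ : ℝ, 0 < δ₀ ∧ ∀ δ : ℝ, 0 < δ → δ ≤ δ₀ →
        (∃ ρw : Weight →L[ℂ] Weight,
          IsDensityOperator ρw ∧ IsMomentumDensity ħ ρw (rescale μ p₀ δ)) ∧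
        ∀ ρw : Weight →L[ℂ] Weight, IsDensityOperator ρw →
          IsMomentumDensity ħ ρw (rescale μ p₀ δ) →
          ∀ ρs : S →L[ℂ] S, IsDensityOperator ρs →
            ∃ σ : S →L[ℂ] S, HasPartialTrace (engineState U ρs ρw) σ ∧
              traceNorm (σ - V ∘L ρs ∘L V.adjoint) ≤ ε) ∧
    -- the error depends only on the concentration of the momentum distribution around `p₀`
    (∀ ε : ℝ, 0 < ε → ∃ η : ℝ, 0 < η ∧
      ∀ (ρw : Weight →L[ℂ] Weight) (μ : ℝ → ℝ),
        IsDensityOperator ρw → IsMomentumDensity ħ ρw μ →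
        ∫ p in {p : ℝ | η ≤ |p - p₀|}, μ p ≤ η →
        ∀ ρs : S →L[ℂ] S, IsDensityOperator ρs →
          ∃ σ : S →L[ℂ] S, HasPartialTrace (engineState U ρs ρw) σ ∧
            traceNorm (σ - V ∘L ρs ∘L V.adjoint) ≤ ε) ∧
    -- the final weight state is a state with the same momentum distribution
    (∀ (ρs : S →L[ℂ] S) (ρw : Weight →L[ℂ] Weight),
      IsDensityOperator ρs → IsDensityOperator ρw →
      IsDensityOperator (partialTraceLeft (engineState U ρs ρw)) ∧
      ∀ μ, IsMomentumDensity ħ (partialTraceLeft (engineState U ρs ρw)) μ ↔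
        IsMomentumDensity ħ ρw μ) ∧
    -- the free evolution of the weight only translates the momentum distribution
    (∀ (ρw : Weight →L[ℂ] Weight) (μ : ℝ → ℝ) (t : ℝ),
      IsDensityOperator ρw → IsMomentumDensity ħ ρw μ →
      weightEvolution ħ t ∈ unitary (Weight →L[ℂ] Weight) ∧
      IsMomentumDensity ħ (weightEvolution ħ t ∘L ρw ∘L (weightEvolution ħ t).adjoint)
        (fun p => μ (p + t))) ∧
    -- permutations of the energy levels are exact on diagonal states, for every weight state
    (∀ π : Equiv.Perm ι, (∀ j, V (b j) = b (π j)) →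
      ∀ (ρs : S →L[ℂ] S) (q : ι → ℝ), IsDensityOperator ρs →
        ρs = ∑ n, (q n : ℂ) • rankOne ℂ (b n) (b n) →
        ∀ ρw : Weight →L[ℂ] Weight, IsDensityOperator ρw →
          HasPartialTrace (engineState U ρs ρw) (V ∘L ρs ∘L V.adjoint)) := by
  have hUs' : Us = systemUnitary ħ b E V p₀ := funext hUs
  subst hUs'
  rw [engineUnitary_eq_fiberOp ħ b E V p₀ hħ] at hU
  subst hU
  have hG := memLp_top_systemUnitary ħ b E V p₀ hV
  have hu := systemUnitary_mem_unitary ħ b E V p₀ hV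
  have hself := systemUnitary_self ħ b E V p₀
  -- the concentration estimate for an engine state, from the one for mixtures of conjugates
  have happrox : ∀ ε : ℝ, 0 < ε → ∃ η : ℝ, 0 < η ∧
      ∀ (ρw : Weight →L[ℂ] Weight) (μ : ℝ → ℝ),
        IsDensityOperator ρw → IsMomentumDensity ħ ρw μ →
        ∫ p in {p : ℝ | η ≤ |p - p₀|}, μ p ≤ η →
        ∀ ρs : S →L[ℂ] S, IsDensityOperator ρs →
          ∃ σ : S →L[ℂ] S,
            HasPartialTrace (engineState (fiberOp ħ b (systemUnitary ħ b E V p₀)) ρs ρw) σ ∧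
              traceNorm (σ - V ∘L ρs ∘L V.adjoint) ≤ ε := fun ε hε => by
    obtain ⟨η, hη, h⟩ := exists_forall_traceNorm_integral_sub_le
      (continuous_systemUnitary ħ b E V p₀) (fun p => norm_le_one_of_mem_unitary (hu p)) p₀ hε
    rw [hself] at h
    exact ⟨η, hη, fun ρw μ hρw hμ hfar ρs hρs =>
      ⟨_, hasPartialTrace_engineState b hħ hG ρs hρw hμ,
        h μ hμ.1 hμ.2.1 (hμ.integral_eq_one hħ hρw) hfar ρs hρs.norm_le_one⟩⟩
  refine ⟨⟨fiberOp_mem_unitary b hħ hG hu, ?_, ?_⟩, ⟨hu, hself, fun a a' φ ψ =>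
      ⟨integrable_momentumWave_mul hħ (memLp_top_inner_apply hG a a') φ ψ,
        inner_tmul_fiberOp_tmul b hħ hG a a' φ ψ⟩⟩,
    fun ρw hρw => ⟨hρw.exists_isMomentumDensity hħ, fun μ hμ => hμ.integral_eq_one hħ hρw⟩,
    fun ρs ρw μ hρs hρw hμ => ⟨integrable_ofReal_smul hμ.2.1 (memLp_top_conj_adjoint hG ρs),
      hasPartialTrace_engineState b hħ hG ρs hρw hμ⟩,
    fun μ h0 hi h1 ε hε => ?_, happrox,
    fun ρs ρw hρs hρw => ⟨isDensityOperator_partialTraceLeft b hħ hG hu hρs hρw,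
      isMomentumDensity_partialTraceLeft_iff b hħ hG hu hρs hρw⟩,
    fun ρw μ t hρw hμ => ⟨weightEvolution_eq hħ t ▸ mulBounded_character_mem_unitary _,
      hμ.weightEvolution_conj hħ hρw t⟩,
    fun π hπ ρs q hρs hq ρw hρw => ?_⟩
  · rw [← engineUnitary_eq_fiberOp ħ b E V p₀ hħ]
    exact commutes_engineUnitary_engineHamiltonian b E V p₀ hħ hHs hE
  · rw [← engineUnitary_eq_fiberOp ħ b E V p₀ hħ]
    exact commutes_engineUnitary_momentumOp b E V p₀ hħ
  · obtain ⟨η, hη, h⟩ := happrox ε hε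
    obtain ⟨δ₀, hδ₀, hfar⟩ := exists_forall_setIntegral_rescale_le h0 hi p₀ hη
    refine ⟨δ₀, hδ₀, fun δ hδ hle => ⟨?_, fun ρw hρw hμ ρs hρs =>
      h ρw _ hρw hμ (hfar δ hδ hle) ρs hρs⟩⟩
    refine exists_isMomentumDensity_eq hħ (fun p => ?_) (integrable_rescale hi p₀ hδ)
      ((integral_rescale μ p₀ hδ).trans h1)
    exact mul_nonneg (by positivity) (h0 _)
  · obtain ⟨μ, hμ⟩ := hρw.exists_isMomentumDensity hħ
    have h := hasPartialTrace_engineState b hħ hG ρs hρw hμ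
    subst hq
    simp_rw [systemUnitary_conj_diagonal ħ b E V p₀ π hπ] at h
    rwa [integral_smul_const, integral_complex_ofReal, hμ.integral_eq_one hħ hρw,
      Complex.ofReal_one, one_smul] at h
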